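/- **Theorem 1.7.** Let $\Sigma=\Sigma_{g,n}$ be the connected orientable surface of genus $g$ with $n$ punctures, of hyperbolic type ($2g-2+n>0$). Let $p:\Sigma'\to\Sigma$ be a finite regular covering with $\Sigma'$ connected and with deck group $\Gamma$, let $\psi$ be a self-homeomorphism of $\Sigma$ under which the covering is invariant, that is, which lifts to $\Sigma'$, and let $\psi':\Sigma'\to\Sigma'$ be a homeomorphism with $p\circ\psi'=\psi\circ p$. Let $F$ be a field of characteristic zero, and let $\psi$ act on $H_1(\Sigma',F)$ by $\psi'_*$. 1. If $H_1(\Sigma',F)$ is irreducible under the action of $\langle\psi\rangle$, then $\Gamma$ is trivial. 2. (Without the assumption of irreducibility.) There is an integer $k>0$ such that for every irreducible $F[\Gamma]$-module $V$ there is an irreducible $(\psi^k,\Gamma)$-submodule $W$ of $H_1(\Sigma',F)$, that is, a nonzero subspace invariant under $(\psi'_*)^{k}$, its inverse and $\Gamma$ and minimal as such, which is $V$-isotypic as an $F[\Gamma]$-module (all its simple $F[\Gamma]$-submodules are isomorphic to $V$). In particular, non-isomorphic $V$ give different $W$. -/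

import Mathlib

open CategoryTheory AlgebraicTopology

universe u v

/-- A triangulation, with vertex set `ι`, of a connected closed (compact, without boundary)
surface. The simplices are the nonempty subsets of the members of `triangles`. -/
structure ClosedTriangulation (ι : Type*) [Fintype ι] [DecidableEq ι] where
  /-- the set of triangles, each given by its three vertices -/
  triangles : Finset (Finset ι)
  card_eq_three : ∀ t ∈ triangles, t.card = 3
  exists_triangle : ∀ v : ι, ∃ t ∈ triangles, v ∈ t
  /-- every edge lies on exactly two triangles -/
  two_triangles : ∀ e : Finset ι, e.card = 2 → (∃ t ∈ triangles, e ⊆ t) →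
    (triangles.filter fun t => e ⊆ t).card = 2
  /-- the link of every vertex is connected (hence it is a circle) -/
  link_connected : ∀ v : ι,
    (SimpleGraph.fromRel fun a b : {a : ι // a ≠ v ∧ ∃ t ∈ triangles, v ∈ t ∧ a ∈ t} =>
      ({v, a.1, b.1} : Finset ι) ∈ triangles).Connected
  /-- the graph of vertices and edges is connected -/
  connected : (SimpleGraph.fromRel fun a b : ι => ∃ t ∈ triangles, a ∈ t ∧ b ∈ t).Connected

namespace ClosedTriangulation

variable {ι : Type*} [Fintype ι] [DecidableEq ι] (K : ClosedTriangulation ι)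

/-- The edges: the two-element subsets of triangles. -/
def edges : Finset (Finset ι) :=
  (Finset.powersetCard 2 Finset.univ).filter fun e => ∃ t ∈ K.triangles, e ⊆ t

/-- The Euler characteristic: vertices minus edges plus triangles. -/
def eulerChar : ℤ := (Fintype.card ι : ℤ) - K.edges.card + K.triangles.card

/-- `K` is orientable: the triangles can be given cyclic orders (`O a b c` says that `a, b, c` is
the chosen cyclic order of the triangle `{a, b, c}`) so that the two triangles on an edge induce
opposite directions on it. -/
def Orientable : Prop :=
  ∃ O : ι → ι → ι → Prop,
    (∀ a b c, O a b c → ({a, b, c} : Finset ι) ∈ K.triangles) ∧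
    (∀ a b c, O a b c → O b c a) ∧
    (∀ a b c, ({a, b, c} : Finset ι) ∈ K.triangles → (O a b c ↔ ¬ O b a c)) ∧
    (∀ a b c d, O a b c → O a b d → c = d)

/-- The geometric realization, in barycentric coordinates, with the vertices in `P` removed. -/
def puncturedRealization (P : Finset ι) : Set (ι → ℝ) :=
  {x | (∀ i, 0 ≤ x i) ∧ ∑ i, x i = 1 ∧ (∃ t ∈ K.triangles, ∀ i, x i ≠ 0 → i ∈ t) ∧
    ∀ p ∈ P, x ≠ Pi.single p 1}

end ClosedTriangulation

/-- `X` is the connected orientable surface of genus `g` with `n` punctures: it is homeomorphic to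
a triangulated closed connected orientable surface of Euler characteristic `2 - 2g` with `n` of the
vertices removed. The triangulation is taken fine enough that no triangle contains two of the
punctures, which is no restriction on `X`. -/
def IsSurfaceOfType (g n : ℕ) (X : Type*) [TopologicalSpace X] : Prop :=
  ∃ (m : ℕ) (K : ClosedTriangulation (Fin m)) (P : Finset (Fin m)),
    K.Orientable ∧ K.eulerChar = 2 - 2 * (g : ℤ) ∧ P.card = n ∧
    (∀ t ∈ K.triangles, (t ∩ P).card ≤ 1) ∧
    Nonempty (X ≃ₜ K.puncturedRealization P)

/-- The deck group of `p : Y → X`: the self-homeomorphisms of `Y` over `X`. -/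
def deckGroup {X Y : Type*} [TopologicalSpace Y] (p : Y → X) : Subgroup (Y ≃ₜ Y) where
  carrier := {γ | ∀ y, p (γ y) = p y}
  one_mem' := fun _ => rfl
  mul_mem' := fun {a b} ha hb y => (ha (b y)).trans (hb y)
  inv_mem' := fun {a} ha y => by
    have h := ha (a.symm y)
    rw [a.apply_symm_apply] at h
    exact h.symm

/-- `p : Y → X` is a finite regular (Galois) covering with path-connected total space. -/
structure IsFiniteRegularCover {X Y : Type*} [TopologicalSpace X] [TopologicalSpace Y]
    (p : Y → X) : Prop where
  isCoveringMap : IsCoveringMap p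
  pathConnected : PathConnectedSpace Y
  finite_fiber : ∀ x, (p ⁻¹' {x}).Finite
  exists_deck : ∀ y z, p y = p z → ∃ γ ∈ deckGroup p, γ y = z

/-- The first singular homology `H₁(Y, F)`. -/
noncomputable abbrev H1 (F : Type u) [Field F] (Y : Type u) [TopologicalSpace Y] : ModuleCat.{u} F :=
  ((singularHomologyFunctor (ModuleCat.{u} F) 1).obj (ModuleCat.of F F)).obj (TopCat.of Y)

/-- The action of the homeomorphism group of `Y` on `H₁(Y, F)`, `h` acting as `h_*`. -/
noncomputable def homologyRep (F : Type u) [Field F] (Y : Type u) [TopologicalSpace Y] :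
    Representation F (Y ≃ₜ Y) (H1 F Y) where
  toFun h := (((singularHomologyFunctor (ModuleCat.{u} F) 1).obj (ModuleCat.of F F)).map
    (TopCat.ofHom (h : C(Y, Y)))).hom
  map_one' := by
    have h : TopCat.ofHom ((1 : Y ≃ₜ Y) : C(Y, Y)) = 𝟙 (TopCat.of Y) := rfl
    rw [h, CategoryTheory.Functor.map_id]
    rfl
  map_mul' a b := by
    have h : TopCat.ofHom ((a * b : Y ≃ₜ Y) : C(Y, Y)) =
      TopCat.ofHom (b : C(Y, Y)) ≫ TopCat.ofHom (a : C(Y, Y)) := rfl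
    rw [h, CategoryTheory.Functor.map_comp]
    rfl

/-- `H₁(Y, F)` as a representation of a group `S` of homeomorphisms of `Y`. -/
noncomputable def homologyRepOn (F : Type u) [Field F] {Y : Type u} [TopologicalSpace Y]
    (S : Subgroup (Y ≃ₜ Y)) : Representation F S (H1 F Y) :=
  (homologyRep F Y).comp S.subtype

/-- The representation `ρ` of `S`, restricted to a subgroup `T ≤ S`. -/
def restrictTo {G F V : Type*} [Group G] [Field F] [AddCommGroup V] [Module F V]
    {S T : Subgroup G} (h : T ≤ S) (ρ : Representation F S V) : Representation F T V :=
  ρ.comp (Subgroup.inclusion h)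

/-! Let H be the first homology of the total space and Γ the deck group. Both parts rest on one
fact, `homology_of_finiteRegularCover`: H is finite-dimensional, and every nonzero
finite-dimensional representation V of Γ receives a nonzero Γ-map from H.

The source of such a map is an Euler characteristic count. The open stars of the non-puncture
vertices cover the base, and the vertices, edges and triangles of their nerve have alternating sum
at most 2 - 2g - n < 0. In the cochains of the nerve with coefficients in V, twisted by the
covering, the 1-cocycles therefore have larger dimension than the coboundaries
(`StarCover.exists_twisted_cocycle`). The star cover lifts to the total space, its members indexed
by a vertex and a deck transformation, and there the twisted cocycle becomes an ordinary V-valued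
one. Integrating it along paths gives an equivariant period map H → V. If this map were zero, the
lifted cocycle would be a coboundary, and averaging over Γ would make the twisted cocycle a
coboundary too (`exists_equivariant_map_ne_zero`). Finite-dimensionality of H comes from the finite
lifted cover (`StarCover.finiteDimensional_H1`).

For part 2, some power of ψ' centralizes Γ, hence preserves the V-isotypic component of H. This
component is nonzero because V is a quotient of H and, by Maschke, a summand; a minimal invariant
subspace of it is the required W. For part 1, taking V trivial yields a nonzero Γ-fixed vector. The
fixed space is ψ'-invariant, so by irreducibility Γ acts trivially on H. If Γ were nontrivial, V
could be the functions on Γ with sum zero, which have no nonzero invariants, so no nonzero Γ-map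
from H could exist. -/

/-! ### Singular 1-chains modulo boundaries -/

namespace SingularChains

open Limits Simplicial Opposite

variable (F : Type u) [Field F] (Y : Type u) [TopologicalSpace Y]

/-- The singular simplicial set. -/
noncomputable abbrev sing : SSet.{u} := TopCat.toSSet.obj (TopCat.of Y)

/-- The singular chain complex with coefficients in `F`. -/
noncomputable abbrev cpx : ChainComplex (ModuleCat.{u} F) ℕ :=
  (sing Y).chainComplex (ModuleCat.of F F)

variable {Y}

/-- The simplex of the singular simplicial set given by a continuous map. -/
noncomputable def mkSimplex {n : ℕ} (f : C(stdSimplex ℝ (Fin (n + 1)), Y)) : (sing Y) _⦋n⦌ :=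
  (TopCat.toSSetObjEquiv (TopCat.of Y) (op ⦋n⦌)).symm f

/-- The singular chain of one simplex. -/
noncomputable def gen {n : ℕ} (f : C(stdSimplex ℝ (Fin (n + 1)), Y)) : (cpx F Y).X n :=
  ((sing Y).ιChainComplex (R := ModuleCat.of F F) (mkSimplex f)).hom (1 : F)

/-- The face inclusion of standard simplices. -/
noncomputable def face {n : ℕ} (i : Fin (n + 2)) :
    C(stdSimplex ℝ (Fin (n + 1)), stdSimplex ℝ (Fin (n + 2))) :=
  ⟨stdSimplex.map i.succAbove, stdSimplex.continuous_map _⟩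

lemma δ_mkSimplex {n : ℕ} (f : C(stdSimplex ℝ (Fin (n + 2)), Y)) (i : Fin (n + 2)) :
    (sing Y).δ i (mkSimplex f) = mkSimplex (f.comp (face i)) := by
  rfl

lemma d_gen {n : ℕ} (f : C(stdSimplex ℝ (Fin (n + 2)), Y)) :
    ((cpx F Y).d (n + 1) n).hom (gen F f) =
      ∑ i : Fin (n + 2), (-1 : ℤ) ^ i.val • gen F (f.comp (face i)) := by
  have h := (sing Y).ιChainComplex_d (R := ModuleCat.of F F) (mkSimplex f)
  have h' := congrArg (fun g => g.hom (1 : F)) h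
  simp only [ModuleCat.hom_comp, LinearMap.comp_apply] at h'
  refine h'.trans ?_
  simp only [δ_mkSimplex, ModuleCat.hom_sum, LinearMap.sum_apply]
  rfl

/-- Singular chains as finitely supported functions. -/
noncomputable def toFinsupp (n : ℕ) :
    (cpx F Y).X n →ₗ[F] (C(stdSimplex ℝ (Fin (n + 1)), Y) →₀ F) :=
  (((sing Y).isColimitChainComplexXCofan (ModuleCat.of F F) n).desc
    (Cofan.mk (ModuleCat.of F (C(stdSimplex ℝ (Fin (n + 1)), Y) →₀ F)) fun s =>
      ModuleCat.ofHom (Finsupp.lsingle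
        (TopCat.toSSetObjEquiv (TopCat.of Y) (op ⦋n⦌) s)))).hom

@[simp] lemma toFinsupp_gen {n : ℕ} (f : C(stdSimplex ℝ (Fin (n + 1)), Y)) :
    toFinsupp F n (gen F f) = Finsupp.single f 1 := by
  have h := ((sing Y).isColimitChainComplexXCofan (ModuleCat.of F F) n).fac
    (Cofan.mk (ModuleCat.of F (C(stdSimplex ℝ (Fin (n + 1)), Y) →₀ F)) fun s =>
      ModuleCat.ofHom (Finsupp.lsingle
        (TopCat.toSSetObjEquiv (TopCat.of Y) (op ⦋n⦌) s))) ⟨mkSimplex f⟩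
  have h' := congrArg (fun g => g.hom (1 : F)) h
  refine h'.trans ?_
  change Finsupp.single (TopCat.toSSetObjEquiv (TopCat.of Y) (op ⦋n⦌) (mkSimplex f)) (1 : F) = _
  rw [mkSimplex]
  erw [Equiv.apply_symm_apply]

/-- Together with `toFinsupp_gen` this shows that the singular simplices form a basis, so that
chains can be handled as finitely supported functions. -/
lemma linearCombination_toFinsupp {n : ℕ} (z : (cpx F Y).X n) :
    Finsupp.linearCombination F (gen F) (toFinsupp F n z) = z := by
  have h : ModuleCat.ofHom (Finsupp.linearCombination F (gen F) ∘ₗ toFinsupp F n) =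
      𝟙 ((cpx F Y).X n) := by
    refine SSet.chainComplex_hom_ext fun s => ?_
    ext
    obtain ⟨f, rfl⟩ := (TopCat.toSSetObjEquiv (TopCat.of Y) (op ⦋n⦌)).symm.surjective s
    change Finsupp.linearCombination F (gen F) (toFinsupp F n (gen F f)) = gen F f
    simp
  exact congrArg (fun g => g.hom z) h

/-- Singular 1-chains modulo boundaries. -/
noncomputable abbrev ChainClass (Y : Type u) [TopologicalSpace Y] : ModuleCat.{u} F :=
  (cpx F Y).opcycles 1

/-- The class of a path modulo boundaries. -/
noncomputable def cls (f : C(stdSimplex ℝ (Fin 2), Y)) : ChainClass F Y :=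
  ((cpx F Y).pOpcycles 1).hom (gen F f)

lemma cls_boundary (f : C(stdSimplex ℝ (Fin 3), Y)) :
    cls F (f.comp (face 0)) + cls F (f.comp (face 2)) = cls F (f.comp (face 1)) := by
  have h := (cpx F Y).d_pOpcycles 2 1
  have h' := congrArg (fun g => g.hom (gen F f)) h
  have h2 : ((cpx F Y).pOpcycles 1).hom (((cpx F Y).d 2 1).hom (gen F f)) = 0 := h'
  rw [d_gen, Fin.sum_univ_three] at h2
  simp only [map_add, map_zsmul] at h2
  change (-1 : ℤ) ^ 0 • cls F (f.comp (face 0)) + (-1 : ℤ) ^ 1 • cls F (f.comp (face 1)) +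
    (-1 : ℤ) ^ 2 • cls F (f.comp (face 2)) = 0 at h2
  simp only [pow_zero, one_smul, pow_one, neg_smul, even_two, Even.neg_pow, one_pow] at h2
  rw [← sub_eq_zero, ← h2]
  abel

/-- The inclusion of `H₁` into chains modulo boundaries. -/
noncomputable def homologyToClass (Y : Type u) [TopologicalSpace Y] : H1 F Y →ₗ[F] ChainClass F Y :=
  ((cpx F Y).homologyι 1).hom

lemma homologyToClass_injective : Function.Injective (homologyToClass F Y) :=
  (ModuleCat.mono_iff_injective ((cpx F Y).homologyι 1)).1 inferInstance

lemma pOpcycles_surjective : Function.Surjective ((cpx F Y).pOpcycles 1).hom :=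
  (ModuleCat.epi_iff_surjective ((cpx F Y).pOpcycles 1)).1 inferInstance

/-- The vertices of a singular simplex. -/
noncomputable def vtx {n : ℕ} (f : C(stdSimplex ℝ (Fin (n + 1)), Y)) (i : Fin (n + 1)) : Y :=
  f (stdSimplex.vertex i)

/-- The boundary of a 1-chain as a finitely supported function on points. -/
noncomputable def bdry (Y : Type u) [TopologicalSpace Y] :
    (C(stdSimplex ℝ (Fin 2), Y) →₀ F) →ₗ[F] (Y →₀ F) :=
  Finsupp.linearCombination F fun f => Finsupp.single (vtx f 1) 1 - Finsupp.single (vtx f 0) 1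

lemma d_gen_zero (f : C(stdSimplex ℝ (Fin 2), Y)) :
    ((cpx F Y).d 1 0).hom (gen F f) = gen F (f.comp (face 0)) - gen F (f.comp (face 1)) := by
  rw [d_gen, Fin.sum_univ_two]
  simp [sub_eq_add_neg]

lemma bdry_toFinsupp (z : (cpx F Y).X 1) :
    bdry F Y (toFinsupp F 1 z) =
      Finsupp.mapDomain (fun f => vtx f 0) (toFinsupp F 0 (((cpx F Y).d 1 0).hom z)) := by
  conv_rhs => rw [← linearCombination_toFinsupp F z]
  generalize toFinsupp F 1 z = w
  induction w using Finsupp.induction_linear with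
  | zero => simp
  | add a b ha hb => simp only [map_add, ha, hb, Finsupp.mapDomain_add]
  | single f c =>
    simp only [bdry, Finsupp.linearCombination_single, map_smul, Finsupp.mapDomain_smul]
    congr 1
    rw [d_gen_zero, map_sub, toFinsupp_gen, toFinsupp_gen, sub_eq_add_neg, sub_eq_add_neg,
      ← Finsupp.single_neg, ← Finsupp.single_neg, Finsupp.mapDomain_add,
      Finsupp.mapDomain_single, Finsupp.mapDomain_single]
    simp [vtx, face]

/-- With `exists_homology_of_cycle` this describes the image of `H1` in `ChainClass`: the classes of
the chains whose end points cancel. All later arguments about homology pass through this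
description. -/
lemma exists_cycle (x : H1 F Y) : ∃ z : C(stdSimplex ℝ (Fin 2), Y) →₀ F,
    bdry F Y z = 0 ∧ homologyToClass F Y x = Finsupp.linearCombination F (cls F) z := by
  obtain ⟨c, hc⟩ := pOpcycles_surjective F (homologyToClass F Y x)
  refine ⟨toFinsupp F 1 c, ?_, ?_⟩
  · have h := congrArg (fun g => g.hom x) ((cpx F Y).homologyι_comp_fromOpcycles 1 0)
    have h1 : ((cpx F Y).fromOpcycles 1 0).hom (homologyToClass F Y x) = 0 := h
    have h2 := congrArg (fun g => g.hom c) ((cpx F Y).p_fromOpcycles 1 0)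
    have h3 : ((cpx F Y).d 1 0).hom c = 0 := by
      rw [← h1, ← hc]; exact h2.symm
    rw [bdry_toFinsupp, h3]
    simp
  · rw [← hc]
    conv_lhs => rw [← linearCombination_toFinsupp F c]
    rw [Finsupp.apply_linearCombination]
    rfl

lemma exists_homology_of_cycle (z : C(stdSimplex ℝ (Fin 2), Y) →₀ F) (hz : bdry F Y z = 0) :
    ∃ x : H1 F Y, homologyToClass F Y x = Finsupp.linearCombination F (cls F) z := by
  set c := Finsupp.linearCombination F (gen F) z with hc
  have hcz : toFinsupp F 1 c = z := by
    rw [hc, Finsupp.apply_linearCombination]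
    have : (toFinsupp F 1 ∘ gen F : C(stdSimplex ℝ (Fin 2), Y) → _) =
      fun f => Finsupp.single f (1 : F) := by ext1 f; simp
    rw [this]
    simp [Finsupp.linearCombination_apply]
  have hd : ((cpx F Y).d 1 0).hom c = 0 := by
    have h := bdry_toFinsupp F c
    rw [hcz, hz] at h
    -- A singular 0-simplex is determined by its point, so vanishing of `bdry` forces the true
    -- differential to vanish.
    have hinj : Function.Injective fun f : C(stdSimplex ℝ (Fin 1), Y) => vtx f 0 := by
      intro f g hfg
      ext t
      have ht : t = stdSimplex.vertex 0 := Subsingleton.elim _ _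
      rw [ht]
      exact hfg
    have h0 := Finsupp.mapDomain_injective hinj (h.symm.trans Finsupp.mapDomain_zero.symm)
    rw [← linearCombination_toFinsupp F (((cpx F Y).d 1 0).hom c), h0]
    simp
  let k : ModuleCat.of F F ⟶ (cpx F Y).X 1 := ModuleCat.ofHom (LinearMap.toSpanSingleton F _ c)
  have hk : k ≫ (cpx F Y).d 1 0 = 0 := by
    ext
    change ((cpx F Y).d 1 0).hom ((1 : F) • c) = 0
    rw [one_smul, hd]
  let l := (cpx F Y).liftCycles k 0 (by simp) hk
  refine ⟨(l ≫ (cpx F Y).homologyπ 1).hom (1 : F), ?_⟩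
  have h : (l ≫ (cpx F Y).homologyπ 1) ≫ (cpx F Y).homologyι 1 = k ≫ (cpx F Y).pOpcycles 1 := by
    simp [l]
  refine (congrArg (fun g => g.hom (1 : F)) h).trans ?_
  change ((cpx F Y).pOpcycles 1).hom ((1 : F) • c) = _
  rw [one_smul, hc, Finsupp.apply_linearCombination]
  rfl

lemma homologyToClass_homologyRep (h : Y ≃ₜ Y) (x : H1 F Y)
    (z : C(stdSimplex ℝ (Fin 2), Y) →₀ F)
    (hz : homologyToClass F Y x = Finsupp.linearCombination F (cls F) z) :
    homologyToClass F Y (homologyRep F Y h x) =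
      Finsupp.linearCombination F (fun f => cls F ((h : C(Y, Y)).comp f)) z := by
  let φ : cpx F Y ⟶ cpx F Y :=
    SSet.chainComplexMap (TopCat.toSSet.map (TopCat.ofHom (h : C(Y, Y)))) (ModuleCat.of F F)
  have h1 := congrArg (fun g => g.hom x) (HomologicalComplex.homologyι_naturality φ 1)
  have h2 : homologyToClass F Y (homologyRep F Y h x) =
      (HomologicalComplex.opcyclesMap φ 1).hom (homologyToClass F Y x) := h1
  have h3 (f : C(stdSimplex ℝ (Fin 2), Y)) : (HomologicalComplex.opcyclesMap φ 1).hom (cls F f) =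
      cls F ((h : C(Y, Y)).comp f) := by
    have h4 := congrArg (fun g => g.hom (gen F f)) (HomologicalComplex.p_opcyclesMap φ 1)
    refine Eq.trans h4 ?_
    have h5 := congrArg (fun g => g.hom (1 : F)) (SSet.ι_chainComplexMap_f (sing Y) (sing Y)
      (TopCat.toSSet.map (TopCat.ofHom (h : C(Y, Y)))) (ModuleCat.of F F) (mkSimplex f))
    exact congrArg ((cpx F Y).pOpcycles 1).hom h5
  rw [h2, hz, Finsupp.apply_linearCombination]
  congr 2
  ext1 f
  exact h3 f

/-- Chains are free on simplices and `ChainClass` is the cokernel of `d 2 1`; additivity of `φ`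
around every singular triangle is exactly vanishing on boundaries. -/
lemma exists_linearMap_of_boundary {V : Type v} [AddCommGroup V] [Module F V]
    (φ : C(stdSimplex ℝ (Fin 2), Y) → V)
    (hφ : ∀ f : C(stdSimplex ℝ (Fin 3), Y),
      φ (f.comp (face 0)) + φ (f.comp (face 2)) = φ (f.comp (face 1))) :
    ∃ Φ : ChainClass F Y →ₗ[F] V, ∀ f, Φ (cls F f) = φ f := by
  let ψ : (cpx F Y).X 1 →ₗ[F] V := Finsupp.linearCombination F φ ∘ₗ toFinsupp F 1
  have hψ (f) : ψ (gen F f) = φ f := by simp [ψ]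
  have hd (y : (cpx F Y).X 2) : ψ (((cpx F Y).d 2 1).hom y) = 0 := by
    rw [← linearCombination_toFinsupp F y]
    generalize toFinsupp F 2 y = w
    induction w using Finsupp.induction_linear with
    | zero => simp
    | add a b ha hb => rw [map_add, map_add, map_add, ha, hb, add_zero]
    | single f c =>
      rw [Finsupp.linearCombination_single, map_smul, map_smul, d_gen, Fin.sum_univ_three]
      simp only [map_add, map_zsmul, hψ]
      rw [← hφ]
      simp
  have hker : LinearMap.ker ((cpx F Y).pOpcycles 1).hom ≤ LinearMap.ker ψ := by
    intro y hy
    have hex : (ShortComplex.mk ((cpx F Y).d 2 1) ((cpx F Y).pOpcycles 1)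
        ((cpx F Y).d_pOpcycles 2 1)).Exact :=
      ShortComplex.exact_of_g_is_cokernel _ ((cpx F Y).opcyclesIsCokernel 2 1 (by simp))
    rw [ShortComplex.moduleCat_exact_iff] at hex
    obtain ⟨w, rfl⟩ := hex y hy
    exact hd w
  let e := ((cpx F Y).pOpcycles 1).hom.quotKerEquivOfSurjective (pOpcycles_surjective F)
  refine ⟨(Submodule.liftQ _ ψ hker) ∘ₗ e.symm.toLinearMap, fun f => ?_⟩
  have : e.symm (cls F f) = Submodule.Quotient.mk (gen F f) := by
    rw [LinearEquiv.symm_apply_eq]; rfl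
  simp only [LinearMap.comp_apply, LinearEquiv.coe_coe, this]
  exact (Submodule.liftQ_apply _ _ _).trans (hψ f)

/-! ### Affine simplices and classes of paths -/

section Affine

variable {E : Type*} [AddCommGroup E] [Module ℝ E] [TopologicalSpace E] [ContinuousAdd E]
  [ContinuousSMul ℝ E]

/-- The affine simplex with given vertices. -/
noncomputable def aff {n : ℕ} (w : Fin (n + 1) → E) : C(stdSimplex ℝ (Fin (n + 1)), E) :=
  ⟨fun t => ∑ i, t i • w i, continuous_finsetSum _ fun i _ =>
    ((continuous_apply i).comp continuous_subtype_val).smul continuous_const⟩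

lemma aff_apply {n : ℕ} (w : Fin (n + 1) → E) (t : stdSimplex ℝ (Fin (n + 1))) :
    aff w t = ∑ i, t i • w i := rfl

lemma aff_comp_face {n : ℕ} (w : Fin (n + 2) → E) (i : Fin (n + 2)) :
    (aff w).comp (face i) = aff (w ∘ i.succAbove) := by
  classical
  ext t
  change ∑ j, (stdSimplex.map i.succAbove t) j • w j = ∑ j, t j • w (i.succAbove j)
  simp only [stdSimplex.map_coe, FunOnFinite.linearMap_apply_apply, Finset.sum_smul]
  rw [← Finset.sum_fiberwise Finset.univ i.succAbove (fun j => t j • w (i.succAbove j))]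
  refine Finset.sum_congr rfl fun j _ => Finset.sum_congr rfl fun k hk => ?_
  rw [(Finset.mem_filter.1 hk).2]

variable (F : Type u) [Field F] {Y : Type u} [TopologicalSpace Y]

/-- The class of the restriction of `f` to the segment from `a` to `b`. -/
noncomputable def seg (f : C(E, Y)) (a b : E) : ChainClass F Y := cls F (f.comp (aff ![a, b]))

/-- The three segments bound the affine triangle on `a, b, c`, which may be degenerate; on the line
this is subdivision of paths. -/
lemma seg_add_seg (f : C(E, Y)) (a b c : E) : seg F f a b + seg F f b c = seg F f a c := by
  have h := cls_boundary F (f.comp (aff ![a, b, c]))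
  simp only [ContinuousMap.comp_assoc, aff_comp_face] at h
  have h0 : (![a, b, c] ∘ (0 : Fin 3).succAbove) = ![b, c] := by ext i; fin_cases i <;> rfl
  have h1 : (![a, b, c] ∘ (1 : Fin 3).succAbove) = ![a, c] := by ext i; fin_cases i <;> rfl
  have h2 : (![a, b, c] ∘ (2 : Fin 3).succAbove) = ![a, b] := by ext i; fin_cases i <;> rfl
  rw [h0, h1, h2, add_comm] at h
  exact h

lemma seg_self (f : C(E, Y)) (a : E) : seg F f a a = 0 := by
  have := seg_add_seg F f a a a
  simpa using this

lemma seg_eq_seg {E' : Type*} [AddCommGroup E'] [Module ℝ E'] [TopologicalSpace E']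
    [ContinuousAdd E'] [ContinuousSMul ℝ E'] (f : C(E, Y)) (g : C(E', Y)) (a b : E) (a' b' : E')
    (h : ∀ r s : ℝ, r + s = 1 → 0 ≤ r → 0 ≤ s → f (r • a + s • b) = g (r • a' + s • b')) :
    seg F f a b = seg F g a' b' := by
  unfold seg
  congr 1
  ext t
  have := t.2.2
  rw [Fin.sum_univ_two] at this
  simpa [aff_apply, Fin.sum_univ_two] using h (t 0) (t 1) this (t.2.1 0) (t.2.1 1)

end Affine

variable (F : Type u) [Field F] {Y : Type u} [TopologicalSpace Y]

/-- A singular 1-simplex, extended to a path on the real line. -/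
noncomputable def toPath (f : C(stdSimplex ℝ (Fin 2), Y)) : C(ℝ, Y) :=
  f.comp ((stdSimplexHomeomorphUnitInterval.symm : C(unitInterval, stdSimplex ℝ (Fin 2))).comp
    ⟨Set.projIcc 0 1 zero_le_one, continuous_projIcc⟩)

lemma toPath_comp_aff (f : C(stdSimplex ℝ (Fin 2), Y)) :
    (toPath f).comp (aff ![0, 1]) = f := by
  ext t
  have h1 : (aff ![(0 : ℝ), 1]) t = t 1 := by simp [aff_apply, Fin.sum_univ_two]
  have h2 : t 1 ∈ Set.Icc (0 : ℝ) 1 := ⟨t.2.1 1, stdSimplex.le_one t 1⟩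
  have h3 : Set.projIcc (0 : ℝ) 1 zero_le_one (t 1) = stdSimplexHomeomorphUnitInterval t := by
    rw [Set.projIcc_of_mem _ h2]; rfl
  change f (stdSimplexHomeomorphUnitInterval.symm
    (Set.projIcc 0 1 zero_le_one (aff ![(0 : ℝ), 1] t))) = f t
  rw [h1, h3, Homeomorph.symm_apply_apply]

lemma seg_toPath (f : C(stdSimplex ℝ (Fin 2), Y)) : seg F (toPath f) 0 1 = cls F f := by
  rw [seg, toPath_comp_aff]

lemma toPath_zero (f : C(stdSimplex ℝ (Fin 2), Y)) : toPath f 0 = vtx f 0 := by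
  conv_rhs => rw [← toPath_comp_aff f]
  simp [vtx, aff_apply, Fin.sum_univ_two]

lemma toPath_one (f : C(stdSimplex ℝ (Fin 2), Y)) : toPath f 1 = vtx f 1 := by
  conv_rhs => rw [← toPath_comp_aff f]
  simp [vtx, aff_apply, Fin.sum_univ_two]

/-- In a homotopy that starts at a constant path, the class of the end path is the difference of
the classes of the tracks of its end points. -/
lemma seg_eq_sub_of_cone (H : C(ℝ × ℝ, Y)) (h0 : ∀ s t, H (0, s) = H (0, t)) (r s : ℝ) :
    seg F H (1, r) (1, s) = seg F H (0, s) (1, s) - seg F H (0, r) (1, r) := by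
  have h1 := seg_add_seg F H (0, r) (1, r) (1, s)
  have h2 := seg_add_seg F H (0, r) (0, s) (1, s)
  have h3 : seg F H (0, r) (0, s) = 0 := by
    have : seg F H (0, r) (0, s) = seg F (ContinuousMap.const ℝ (H (0, 0))) 0 0 :=
      seg_eq_seg F _ _ _ _ _ _ fun a b _ _ _ => by simpa using h0 _ _
    rw [this, seg_self]
  rw [h3, zero_add] at h2
  rw [← h1] at h2
  rw [h2]
  abel

end SingularChains

/-! ### Star covers and finite-dimensionality of the first homology -/

/-- An open cover by sets with a contraction to a point, whose pairwise intersections are empty or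
path connected. -/
structure StarCover (ι : Type*) (Y : Type*) [TopologicalSpace Y] where
  /-- the members of the cover -/
  U : ι → Set Y
  isOpen_U : ∀ i, IsOpen (U i)
  exists_mem : ∀ y, ∃ i, y ∈ U i
  /-- the contraction -/
  contr : ∀ i, C(ℝ × U i, U i)
  contr_zero : ∀ i x y, contr i (0, x) = contr i (0, y)
  contr_one : ∀ i x, contr i (1, x) = x
  joinedIn : ∀ i j x y, x ∈ U i ∩ U j → y ∈ U i ∩ U j → JoinedIn (U i ∩ U j) x y

namespace StarCover

open SingularChains

variable {ι : Type*} {Y : Type u} [TopologicalSpace Y] (S : StarCover ι Y)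

/-- The track of a point under the contraction. -/
noncomputable def track (i : ι) (x : S.U i) : C(ℝ, Y) :=
  ⟨fun s => S.contr i (s, x), by fun_prop⟩

variable (F : Type u) [Field F]

/-- The class of the track of a point. -/
noncomputable def trackClass (i : ι) (x : S.U i) : ChainClass F Y := seg F (S.track i x) 0 1

/-- Coning the path off by the contraction of `U i` gives a homotopy that starts at a constant path,
so `seg_eq_sub_of_cone` applies. -/
lemma seg_eq_trackClass_sub (i : ι) (τ : C(ℝ, S.U i)) (σ : C(ℝ, Y)) (r s : ℝ)
    (h : ∀ t ∈ Set.uIcc r s, σ t = τ t) :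
    seg F σ r s = S.trackClass F i (τ s) - S.trackClass F i (τ r) := by
  let H : C(ℝ × ℝ, Y) := ⟨fun q => S.contr i (q.1, τ q.2), by fun_prop⟩
  have h1 := seg_eq_sub_of_cone F H (fun s t => congrArg Subtype.val (S.contr_zero i _ _)) r s
  have h2 (t : ℝ) : seg F H (0, t) (1, t) = S.trackClass F i (τ t) := by
    refine seg_eq_seg F _ _ _ _ _ _ fun a b hab _ _ => ?_
    have : a * t + b * t = t := by rw [← add_mul, hab, one_mul]
    simp [H, track, this]
  have h3 : seg F H (1, r) (1, s) = seg F σ r s := by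
    refine seg_eq_seg F _ _ _ _ _ _ fun a b hab ha hb => ?_
    have h4 : a • r + b • s ∈ Set.uIcc r s := by
      rw [← segment_eq_uIcc]
      exact ⟨a, b, ha, hb, hab, rfl⟩
    rw [h _ h4]
    simp [H, hab, S.contr_one]
  rw [← h3, h1, h2, h2]

/-- The class of a path from `x` to `y` inside the overlap can be computed by either contraction;
comparing the two results gives the equality. -/
lemma trackClass_sub_eq (i j : ι) (x y : Y) (hxi : x ∈ S.U i) (hxj : x ∈ S.U j) (hyi : y ∈ S.U i)
    (hyj : y ∈ S.U j) :
    S.trackClass F i ⟨x, hxi⟩ - S.trackClass F j ⟨x, hxj⟩ =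
      S.trackClass F i ⟨y, hyi⟩ - S.trackClass F j ⟨y, hyj⟩ := by
  obtain ⟨γ, hγ⟩ := S.joinedIn i j x y ⟨hxi, hxj⟩ ⟨hyi, hyj⟩
  let σ : C(ℝ, Y) := ⟨γ.extend, γ.continuous_extend⟩
  have hσ (t) : σ t ∈ S.U i ∩ S.U j := by
    simp only [σ, ContinuousMap.coe_mk]
    exact hγ _
  have h0 : σ 0 = x := γ.extend_zero
  have h1 : σ 1 = y := γ.extend_one
  have hi := S.seg_eq_trackClass_sub F i ⟨fun t => ⟨σ t, (hσ t).1⟩, by fun_prop⟩ σ 0 1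
    fun _ _ => rfl
  have hj := S.seg_eq_trackClass_sub F j ⟨fun t => ⟨σ t, (hσ t).2⟩, by fun_prop⟩ σ 0 1
    fun _ _ => rfl
  simp only [ContinuousMap.coe_mk, h0, h1] at hi hj
  rw [hi] at hj
  rw [sub_eq_sub_iff_add_eq_add] at hj ⊢
  rw [add_comm, ← hj, add_comm]

/-- A choice of a member of the cover for every point. -/
noncomputable def idx (y : Y) : ι := (S.exists_mem y).choose

lemma mem_idx (y : Y) : y ∈ S.U (S.idx y) := (S.exists_mem y).choose_spec

/-- The class of the track of a point in the chosen member of the cover. -/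
noncomputable def pointClass (y : Y) : ChainClass F Y := S.trackClass F (S.idx y) ⟨y, S.mem_idx y⟩

/-- The span of the classes of loops through two members of the cover. -/
noncomputable def edgeSpan : Submodule F (ChainClass F Y) :=
  Submodule.span F {q | ∃ i j, ∃ (x : Y) (hi : x ∈ S.U i) (hj : x ∈ S.U j),
    q = S.trackClass F i ⟨x, hi⟩ - S.trackClass F j ⟨x, hj⟩}

/-- By `trackClass_sub_eq` a generator depends only on the pair of indices, so there are finitely
many. -/
lemma finiteDimensional_edgeSpan [Finite ι] : FiniteDimensional F (S.edgeSpan F) := by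
  classical
  have hfin : Set.Finite {q : ChainClass F Y | ∃ i j, ∃ (x : Y) (hi : x ∈ S.U i) (hj : x ∈ S.U j),
      q = S.trackClass F i ⟨x, hi⟩ - S.trackClass F j ⟨x, hj⟩} := by
    refine (Set.finite_range fun a : ι × ι =>
      if h : ∃ x, x ∈ S.U a.1 ∧ x ∈ S.U a.2 then
        S.trackClass F a.1 ⟨h.choose, h.choose_spec.1⟩ -
          S.trackClass F a.2 ⟨h.choose, h.choose_spec.2⟩ else 0).subset ?_
    rintro _ ⟨i, j, x, hi, hj, rfl⟩
    refine ⟨(i, j), ?_⟩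
    have h : ∃ x, x ∈ S.U i ∧ x ∈ S.U j := ⟨x, hi, hj⟩
    simp only [dif_pos h]
    exact S.trackClass_sub_eq F i j _ _ _ _ _ _
  exact FiniteDimensional.span_of_finite F hfin

lemma seg_sub_mem_edgeSpan_of_subset (i : ι) (σ : C(ℝ, Y)) {r s : ℝ} (hrs : r ≤ s)
    (h : ∀ t ∈ Set.Icc r s, σ t ∈ S.U i) :
    seg F σ r s - (S.pointClass F (σ s) - S.pointClass F (σ r)) ∈ S.edgeSpan F := by
  let τ : C(ℝ, S.U i) := ⟨fun t => ⟨σ (Set.projIcc r s hrs t), h _ (Set.projIcc r s hrs t).2⟩,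
    by fun_prop⟩
  have hτ (t) (ht : t ∈ Set.Icc r s) : σ t = τ t := by
    simp [τ, Set.projIcc_of_mem hrs ht]
  have h1 := S.seg_eq_trackClass_sub F i τ σ r s fun t ht => hτ t (by rwa [Set.uIcc_of_le hrs] at ht)
  have key (t) (ht : t ∈ Set.Icc r s) :
      S.trackClass F i (τ t) - S.pointClass F (σ t) ∈ S.edgeSpan F := by
    refine Submodule.subset_span ⟨i, S.idx (σ t), σ t, h t ht, S.mem_idx _, ?_⟩
    have : τ t = ⟨σ t, h t ht⟩ := Subtype.ext (hτ t ht).symm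
    rw [this]; rfl
  rw [h1]
  convert Submodule.sub_mem _ (key s ⟨hrs, le_rfl⟩) (key r ⟨le_rfl, hrs⟩) using 1
  abel

/-- A Lebesgue subdivision cuts the path into pieces that each lie in one member; the point classes
at the intermediate times telescope. -/
lemma cls_sub_mem_edgeSpan (f : C(stdSimplex ℝ (Fin 2), Y)) :
    cls F f - (S.pointClass F (vtx f 1) - S.pointClass F (vtx f 0)) ∈ S.edgeSpan F := by
  rw [← seg_toPath, ← toPath_zero, ← toPath_one]
  set σ := toPath f
  obtain ⟨t, t0, tmono, ⟨n, hn⟩, ht⟩ := exists_monotone_Icc_subset_open_cover_Icc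
    (zero_le_one : (0 : ℝ) ≤ 1) (c := fun i => {x : Set.Icc (0 : ℝ) 1 | σ x ∈ S.U i})
    (fun i => (S.isOpen_U i).preimage (by fun_prop))
    (fun x _ => by simpa using S.exists_mem (σ x))
  suffices ∀ n, seg F σ 0 (t n) - (S.pointClass F (σ (t n)) - S.pointClass F (σ 0)) ∈
      S.edgeSpan F by
    simpa [hn n le_rfl] using this n
  intro n
  induction n with
  | zero => simp [t0, seg_self]
  | succ n ih =>
    obtain ⟨i, hi⟩ := ht n
    have h1 := S.seg_sub_mem_edgeSpan_of_subset F i σ (r := t n) (s := t (n + 1))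
      (tmono n.le_succ) fun x hx => hi
        (show (⟨x, (t n).2.1.trans hx.1, hx.2.trans (t (n + 1)).2.2⟩ : Set.Icc (0 : ℝ) 1) ∈ _
          from ⟨hx.1, hx.2⟩)
    rw [← seg_add_seg F σ 0 (t n)]
    convert Submodule.add_mem _ ih h1 using 1
    abel

/-- The first homology of a space with a finite star cover is finite-dimensional. -/
theorem finiteDimensional_H1 [Finite ι] (S : StarCover ι Y) : FiniteDimensional F (H1 F Y) := by
  have := S.finiteDimensional_edgeSpan F
  have hmem (x : H1 F Y) : homologyToClass F Y x ∈ S.edgeSpan F := by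
    obtain ⟨z, hz, hx⟩ := exists_cycle F x
    let G : (Y →₀ F) →ₗ[F] ChainClass F Y := Finsupp.linearCombination F (S.pointClass F)
    -- Modulo `edgeSpan` the class of a chain depends only on its boundary, so cycles land in
    -- `edgeSpan`.
    have key (w : C(stdSimplex ℝ (Fin 2), Y) →₀ F) :
        Finsupp.linearCombination F (cls F) w - G (bdry F Y w) ∈ S.edgeSpan F := by
      induction w using Finsupp.induction_linear with
      | zero => simp
      | add a b ha hb =>
        simp only [map_add]
        convert Submodule.add_mem _ ha hb using 1
        abel
      | single f c =>
        have := Submodule.smul_mem _ c (S.cls_sub_mem_edgeSpan F f)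
        simpa [bdry, G, smul_sub] using this
    have := key z
    rw [hz, map_zero, sub_zero, ← hx] at this
    exact this
  exact FiniteDimensional.of_injective ((homologyToClass F Y).codRestrict _ hmem)
    fun a b hab => homologyToClass_injective F (congrArg Subtype.val hab)

end StarCover

open Topology

/-! ### Cocycles on the nerve of a cover and their periods -/

section Potential

variable {ι Y D V : Type*} [TopologicalSpace D] [AddCommGroup V]

/-- `h` is a primitive, along `f : D → Y`, of the cochain `ε` on the nerve of a cover of `Y`, where
`c` chooses a member of the cover for every point. -/
def IsPotential (c : Y → ι) (ε : ι → ι → V) (f : D → Y) (h : D → V) : Prop :=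
  ∀ x, ∀ᶠ y in 𝓝 x, h y = h x + ε (c (f x)) (c (f y))

variable {c : Y → ι} {ε : ι → ι → V}

lemma IsPotential.comp {D' : Type*} [TopologicalSpace D'] {f : D → Y} {h : D → V}
    (H : IsPotential c ε f h) {g : D' → D} (hg : Continuous g) :
    IsPotential c ε (f ∘ g) (h ∘ g) :=
  fun x => (hg.tendsto x).eventually (H (g x))

/-- Two primitives of the same cocycle differ by a locally constant function. -/
lemma IsPotential.sub_eq_sub [PreconnectedSpace D] {f : D → Y} {h h' : D → V}
    (H : IsPotential c ε f h) (H' : IsPotential c ε f h') (x y : D) :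
    h x - h y = h' x - h' y := by
  have hloc : IsLocallyConstant fun x => h x - h' x := by
    rw [IsLocallyConstant.iff_eventually_eq]
    intro x
    filter_upwards [H x, H' x] with y h1 h2
    rw [h1, h2]
    abel
  have := hloc.apply_eq_of_preconnectedSpace x y
  rw [sub_eq_sub_iff_add_eq_add] at this ⊢
  rw [this, add_comm]

variable [TopologicalSpace Y] {U : ι → Set Y}

/-- The covering space of `Y` with fibre `V` that is defined by a cocycle. -/
def cocycleBundleCore [TopologicalSpace V] [DiscreteTopology V] (hU : ∀ i, IsOpen (U i))
    (hc : ∀ y, y ∈ U (c y))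
    (hε : ∀ i j k y, y ∈ U i → y ∈ U j → y ∈ U k → ε i j + ε j k = ε i k) :
    FiberBundleCore ι Y V where
  baseSet := U
  isOpen_baseSet := hU
  indexAt := c
  mem_baseSet_at := hc
  coordChange i j _ m := m + ε i j
  coordChange_self i x hx m := by simpa using hε i i i x hx hx hx
  continuousOn_coordChange i j := by fun_prop
  coordChange_comp i j k x hx m := by rw [add_assoc, hε i j k x hx.1.1 hx.1.2 hx.2]

/-- The cocycle glues the sets `U i × V`, with `V` discrete, to a covering space of `Y`. The
homotopy begins at a constant map, so it lifts; the fibre coordinate of the lift at time 1 is the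
primitive. -/
lemma exists_isPotential (hU : ∀ i, IsOpen (U i)) (hc : ∀ y, y ∈ U (c y))
    (hε : ∀ i j k y, y ∈ U i → y ∈ U j → y ∈ U k → ε i j + ε j k = ε i k)
    (H : C(unitInterval × D, Y)) (h0 : ∀ x y, H (0, x) = H (0, y)) :
    ∃ h, IsPotential c ε (fun x => H (1, x)) h := by
  rcases isEmpty_or_nonempty D with hD | ⟨⟨d⟩⟩
  · exact ⟨fun x => hD.elim x, fun x => hD.elim x⟩
  let _ : TopologicalSpace V := ⊥
  have : DiscreteTopology V := ⟨rfl⟩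
  let Z := cocycleBundleCore hU hc hε
  have cov : IsCoveringMap Z.proj := FiberBundle.isCoveringMap (F := V) (E := Z.Fiber)
  let e0 : Z.TotalSpace := ⟨H (0, d), (0 : V)⟩
  let G := cov.liftHomotopy H (ContinuousMap.const D e0) fun x => h0 x d
  have hG (x : D) : (G (1, x)).1 = H (1, x) := congrFun (cov.liftHomotopy_lifts H _ _) (1, x)
  let fib : D → V := fun x => (G (1, x)).2
  refine ⟨fib, fun x => ?_⟩
  let i := c (H (1, x))
  have hsrc (y : D) (hy : H (1, y) ∈ U i) : G (1, y) ∈ (Z.localTriv i).source := by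
    rw [FiberBundleCore.mem_localTriv_source, hG]; exact hy
  have hcont : ContinuousAt (fun y : D => (Z.localTriv i (G (1, y))).2) x := by
    refine continuousAt_snd.comp (((Z.localTriv i).continuousAt (hsrc x (hc _))).comp
      (f := fun y : D => G (1, y)) ?_)
    fun_prop
  -- In the fixed chart `i` the coordinate is locally constant. The primitive reads each point in
  -- its own chart `c (H (1, y))`, and the change of chart produces the `ε` term.
  have hval (y : D) : (Z.localTriv i (G (1, y))).2 = fib y + ε (c (H (1, y))) i := by
    rw [FiberBundleCore.localTriv_apply, ← hG]
    rfl
  have hev := hcont.eventually_mem (s := {(Z.localTriv i (G (1, x))).2})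
    ((isOpen_discrete _).mem_nhds rfl)
  have hev2 : ∀ᶠ y in 𝓝 x, H (1, y) ∈ U i := by
    have : Continuous fun y => H (1, y) := by fun_prop
    exact this.continuousAt.eventually_mem ((hU i).mem_nhds (hc _))
  filter_upwards [hev, hev2] with y h1 h2
  rw [Set.mem_singleton_iff, hval, hval] at h1
  have e1 : ε i i = 0 := by simpa using hε i i i _ (hc _) (hc _) (hc _)
  have e2 : ε i (c (H (1, y))) + ε (c (H (1, y))) i = 0 := by
    rw [hε _ _ _ _ h2 (hc _) h2, e1]
  change fib y = fib x + ε i (c (H (1, y)))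
  change fib y + ε (c (H (1, y))) i = fib x + ε i i at h1
  rw [e1, add_zero] at h1
  rw [← h1, add_assoc, add_comm (ε _ i), e2, add_zero]

/-- The contraction of the standard simplex to a vertex. -/
noncomputable def simplexContraction (n : ℕ) :
    C(unitInterval × stdSimplex ℝ (Fin (n + 1)), stdSimplex ℝ (Fin (n + 1))) :=
  ⟨fun q => ⟨(1 - q.1 : ℝ) • (stdSimplex.vertex (S := ℝ) (0 : Fin (n + 1))).1 + (q.1 : ℝ) • q.2.1,
    convex_stdSimplex ℝ _ (Subtype.prop _) q.2.2 (sub_nonneg.2 q.1.2.2) q.1.2.1 (by ring)⟩, by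
    fun_prop⟩

lemma exists_isPotential_simplex (hU : ∀ i, IsOpen (U i)) (hc : ∀ y, y ∈ U (c y))
    (hε : ∀ i j k y, y ∈ U i → y ∈ U j → y ∈ U k → ε i j + ε j k = ε i k) {n : ℕ}
    (f : C(stdSimplex ℝ (Fin (n + 1)), Y)) : ∃ h, IsPotential c ε f h := by
  obtain ⟨h, hh⟩ := exists_isPotential hU hc hε (f.comp (simplexContraction n)) fun x y => by
    simp [simplexContraction]
  refine ⟨h, ?_⟩
  convert hh using 2 with x
  simp [simplexContraction]

open SingularChains in
/-- The period map of a cocycle. -/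
theorem exists_period {Y : Type u} [TopologicalSpace Y] {c : Y → ι} {U : ι → Set Y}
    {V : Type v} [AddCommGroup V] {ε : ι → ι → V} (F : Type u) [Field F] [Module F V]
    (hU : ∀ i, IsOpen (U i)) (hc : ∀ y, y ∈ U (c y))
    (hε : ∀ i j k y, y ∈ U i → y ∈ U j → y ∈ U k → ε i j + ε j k = ε i k) :
    ∃ Φ : ChainClass F Y →ₗ[F] V, ∀ (f : C(stdSimplex ℝ (Fin 2), Y)) (h : _ → V),
      IsPotential c ε f h →
        Φ (cls F f) = h (stdSimplex.vertex 1) - h (stdSimplex.vertex 0) := by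
  choose P hP using fun f : C(stdSimplex ℝ (Fin 2), Y) => exists_isPotential_simplex hU hc hε f
  have huniq (f : C(stdSimplex ℝ (Fin 2), Y)) (h : _ → V) (hh : IsPotential c ε f h) :
      P f (stdSimplex.vertex 1) - P f (stdSimplex.vertex 0) =
        h (stdSimplex.vertex 1) - h (stdSimplex.vertex 0) :=
    (hP f).sub_eq_sub hh _ _
  obtain ⟨Φ, hΦ⟩ := exists_linearMap_of_boundary F
    (fun f => P f (stdSimplex.vertex 1) - P f (stdSimplex.vertex 0)) fun f => by
      obtain ⟨h, hh⟩ := exists_isPotential_simplex hU hc hε f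
      -- One primitive on the whole triangle restricts to all three faces, so the boundary relation
      -- telescopes.
      rw [huniq (f.comp (face 0)) (h ∘ face 0) (hh.comp (face 0).continuous), huniq (f.comp (face 1)) (h ∘ face 1) (hh.comp (face 1).continuous),
        huniq (f.comp (face 2)) (h ∘ face 2) (hh.comp (face 2).continuous)]
      have h1 : Fin.succAbove (2 : Fin 3) (1 : Fin 2) = 1 := rfl
      simp [face, h1]
  exact ⟨Φ, fun f h hh => (hΦ f).trans (huniq f h hh)⟩

end Potential

/-! ### Lifting a star cover to a finite regular covering -/

section DeckGroup

variable {X X' : Type*} [TopologicalSpace X] [TopologicalSpace X'] {p : X' → X}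

/-- Both are lifts of `p` along itself, and lifts from a connected space that agree at one point are
equal. -/
lemma deckGroup_ext (hp : IsFiniteRegularCover p) {a b : deckGroup p} {y : X'}
    (h : a.1 y = b.1 y) : a = b := by
  have := hp.pathConnected
  refine Subtype.ext (Homeomorph.ext fun z => ?_)
  refine congrFun (hp.isCoveringMap.eq_of_comp_eq a.1.continuous b.1.continuous ?_ y h) z
  ext z
  simp only [Function.comp_apply]
  rw [a.2, b.2]

lemma finite_deckGroup (hp : IsFiniteRegularCover p) : Finite (deckGroup p) := by
  have := hp.pathConnected
  obtain ⟨y⟩ := this.nonempty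
  have := (hp.finite_fiber (p y)).to_subtype
  exact Finite.of_injective (fun a : deckGroup p => (⟨a.1 y, a.2 y⟩ : p ⁻¹' {p y}))
    fun a b hab => deckGroup_ext hp (congrArg Subtype.val hab)

/-- The contraction of the member starts at a constant map, so it lifts from any point of the fibre
over the centre; time 1 of the lift is a section. -/
lemma exists_section {ι : Type*} (hp : IsFiniteRegularCover p) (hsurj : Function.Surjective p)
    (S : StarCover ι X) (v : ι) : ∃ s : C(S.U v, X'), ∀ x, p (s x) = x := by
  rcases isEmpty_or_nonempty (S.U v) with hD | ⟨⟨x0⟩⟩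
  · exact ⟨⟨fun x => hD.elim x, continuous_of_const fun x => hD.elim x⟩, fun x => hD.elim x⟩
  obtain ⟨e, he⟩ := hsurj (S.contr v (0, x0))
  let H : C(unitInterval × S.U v, X) := ⟨fun q => S.contr v (q.1, q.2), by fun_prop⟩
  let G := hp.isCoveringMap.liftHomotopy H (ContinuousMap.const _ e) fun x => by
    rw [ContinuousMap.const_apply, he]
    exact congrArg Subtype.val (S.contr_zero v x x0)
  refine ⟨G.comp ⟨fun x => (1, x), by fun_prop⟩, fun x => ?_⟩
  have := congrFun (hp.isCoveringMap.liftHomotopy_lifts H (ContinuousMap.const _ e) fun x => by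
    rw [ContinuousMap.const_apply, he]
    exact congrArg Subtype.val (S.contr_zero v x x0)) (1, x)
  refine Eq.trans this ?_
  simp [H, S.contr_one]

/-- The members of the cover of the total space. -/
def liftedSet {ι : Type*} {S : StarCover ι X} (s : ∀ v, C(S.U v, X')) (a : ι × deckGroup p) :
    Set X' :=
  {y | ∃ h : p y ∈ S.U a.1, a.2.1 (s a.1 ⟨p y, h⟩) = y}

/-- Over `p ⁻¹' S.U a.1` the set is the equalizer of two lifts of `p`, the translated section and
the inclusion; it is open because `p` is locally injective. -/
lemma isOpen_liftedSet {ι : Type*} (hp : IsFiniteRegularCover p) {S : StarCover ι X}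
    {s : ∀ v, C(S.U v, X')} (hs : ∀ v x, p (s v x) = x) (a : ι × deckGroup p) :
    IsOpen (liftedSet s a) := by
  have hc := hp.isCoveringMap.continuous
  have hW : IsOpen (p ⁻¹' S.U a.1) := (S.isOpen_U a.1).preimage hc
  have h1 := hp.isCoveringMap.isLocalHomeomorph.isLocallyInjective.isOpen_eqLocus
    (g₁ := fun y : p ⁻¹' S.U a.1 => a.2.1 (s a.1 ⟨p y, y.2⟩)) (g₂ := fun y => y.1)
    (by fun_prop) (by fun_prop) (by
      ext y
      simp only [Function.comp_apply]
      rw [a.2.2, hs])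
  have h2 := hW.isOpenEmbedding_subtypeVal.isOpenMap _ h1
  convert h2 using 1
  ext y
  constructor
  · rintro ⟨h, hy⟩
    exact ⟨⟨y, h⟩, hy, rfl⟩
  · rintro ⟨z, hz, rfl⟩
    exact ⟨z.2, hz⟩

/-- A star cover of the base of a finite regular covering lifts to the total space, the members
over one member of the base forming a torsor under the deck group. -/
theorem exists_lifted_starCover {ι : Type*} (hp : IsFiniteRegularCover p)
    (hsurj : Function.Surjective p) (S : StarCover ι X) :
    ∃ (g : ι → ι → deckGroup p) (S' : StarCover (ι × deckGroup p) X')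
      (c : X' → ι × deckGroup p),
      (∀ v w u x, x ∈ S.U v → x ∈ S.U w → x ∈ S.U u → g w u * g v w = g v u) ∧
      (∀ y, y ∈ S'.U (c y)) ∧
      (∀ (γ : deckGroup p) y, c (γ.1 y) = ((c y).1, γ * (c y).2)) ∧
      (∀ a y, y ∈ S'.U a → p y ∈ S.U a.1) ∧
      (∀ a b y, y ∈ S'.U a → y ∈ S'.U b → b.2 * g a.1 b.1 = a.2) ∧
      (∀ v w x, x ∈ S.U v → x ∈ S.U w → ∀ γ, ∃ y, y ∈ S'.U (v, γ) ∧
        y ∈ S'.U (w, γ * (g v w)⁻¹)) := by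
  classical
  have hcov := hp.isCoveringMap
  choose s hs using exists_section hp hsurj S
  have hpγ (γ : deckGroup p) (y) : p (γ.1 y) = p y := γ.2 y
  -- The overlap is connected, so the deck transformation matching the two sections at one point
  -- matches them throughout; for an empty overlap any value serves.
  have hg : ∀ v w, ∃ g : deckGroup p, ∀ x (hv : x ∈ S.U v) (hw : x ∈ S.U w),
      g.1 (s v ⟨x, hv⟩) = s w ⟨x, hw⟩ := by
    intro v w
    by_cases hne : ∃ x, x ∈ S.U v ∩ S.U w
    · obtain ⟨x0, hx0⟩ := hne
      obtain ⟨g, hg, hg0⟩ := hp.exists_deck (s v ⟨x0, hx0.1⟩) (s w ⟨x0, hx0.2⟩) (by rw [hs, hs])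
      refine ⟨⟨g, hg⟩, fun x hv hw => ?_⟩
      have hpre : IsPreconnected (S.U v ∩ S.U w) :=
        IsPathConnected.isConnected ⟨x0, hx0, fun {y} hy => S.joinedIn v w _ _ hx0 hy⟩
          |>.isPreconnected
      have : PreconnectedSpace ↥(S.U v ∩ S.U w) := isPreconnected_iff_preconnectedSpace.1 hpre
      refine congrFun (hcov.eq_of_comp_eq
        (g₁ := fun y : ↥(S.U v ∩ S.U w) => g (s v ⟨y.1, y.2.1⟩))
        (g₂ := fun y : ↥(S.U v ∩ S.U w) => s w ⟨y.1, y.2.2⟩) (by fun_prop) (by fun_prop) ?_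
        ⟨x0, hx0⟩ hg0) ⟨x, hv, hw⟩
      ext y
      simp only [Function.comp_apply]
      rw [hg, hs, hs]
    · exact ⟨1, fun x hv hw => absurd ⟨x, hv, hw⟩ hne⟩
  choose g hg using hg
  have hdeck (v : ι) (y : X') (h : p y ∈ S.U v) : ∃ γ : deckGroup p, γ.1 (s v ⟨p y, h⟩) = y := by
    obtain ⟨γ, hγ, h⟩ := hp.exists_deck (s v ⟨p y, h⟩) y (hs _ _)
    exact ⟨⟨γ, hγ⟩, h⟩
  have hmeet (a b : ι × deckGroup p) (y) (ha : y ∈ liftedSet s a) (hb : y ∈ liftedSet s b) :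
      b.2 * g a.1 b.1 = a.2 := by
    obtain ⟨h1, h2⟩ := ha
    obtain ⟨h3, h4⟩ := hb
    refine deckGroup_ext hp (y := s a.1 ⟨p y, h1⟩) ?_
    change b.2.1 ((g a.1 b.1).1 _) = _
    rw [hg _ _ _ _ h3, h4, h2]
  have hmem (v) (γ : deckGroup p) (x) (h : x ∈ S.U v) : γ.1 (s v ⟨x, h⟩) ∈ liftedSet s (v, γ) := by
    have h0 : p (γ.1 (s v ⟨x, h⟩)) = x := by rw [hpγ, hs]
    exact ⟨by rw [h0]; exact h, by simp only [h0]⟩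
  -- The vertex index is chosen from `p y` alone and only the sheet depends on `y`; this makes the
  -- choice function of the lifted cover equivariant.
  choose! γc hγc using fun y => hdeck (S.idx (p y)) y (S.mem_idx _)
  let S' : StarCover (ι × deckGroup p) X' :=
    { U := liftedSet s
      isOpen_U := isOpen_liftedSet hp hs
      exists_mem := fun y => ⟨(S.idx (p y), γc y), S.mem_idx _, hγc y⟩
      contr := fun a => ⟨fun q => ⟨a.2.1 (s a.1 (S.contr a.1 (q.1, ⟨p q.2.1, q.2.2.1⟩))),
        hmem _ _ _ (S.contr a.1 (q.1, ⟨p q.2.1, q.2.2.1⟩)).2⟩, by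
          have := hcov.continuous
          fun_prop⟩
      contr_zero := fun a x y => Subtype.ext (by
        simp only [ContinuousMap.coe_mk]
        rw [S.contr_zero a.1 ⟨p x.1, x.2.1⟩ ⟨p y.1, y.2.1⟩])
      contr_one := fun a x => Subtype.ext (by
        simp only [ContinuousMap.coe_mk]
        rw [S.contr_one]
        exact x.2.2)
      joinedIn := fun a b x y hx hy => by
        obtain ⟨α, hα⟩ := S.joinedIn a.1 b.1 (p x) (p y) ⟨hx.1.1, hx.2.1⟩ ⟨hy.1.1, hy.2.1⟩
        have hab := hmeet a b x hx.1 hx.2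
        refine ⟨⟨⟨fun t => a.2.1 (s a.1 ⟨α t, (hα t).1⟩), by fun_prop⟩, ?_, ?_⟩, fun t => ⟨?_, ?_⟩⟩
        · simp only [Path.source]
          exact hx.1.2
        · simp only [Path.target]
          exact hy.1.2
        · exact hmem _ _ _ (hα t).1
        · have h1 := hmem b.1 b.2 _ (hα t).2
          rw [← hg a.1 b.1 _ (hα t).1] at h1
          have h2 : a.2.1 (s a.1 ⟨α t, (hα t).1⟩) = (b.2 * g a.1 b.1).1 (s a.1 ⟨α t, (hα t).1⟩) := by
            rw [hab]
          exact h2 ▸ h1 }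
  refine ⟨g, S', fun y => (S.idx (p y), γc y), ?_, fun y => ⟨S.mem_idx _, hγc y⟩, ?_,
    fun a y h => h.1, hmeet, ?_⟩
  · intro v w u x hv hw hu
    refine deckGroup_ext hp (y := s v ⟨x, hv⟩) ?_
    change (g w u).1 ((g v w).1 _) = _
    rw [hg _ _ _ _ hw, hg _ _ _ _ hu, hg]
  · intro γ y
    have h1 : ∀ x, p (γ.1 y) = x →
        (γc (γ.1 y)).1 (s (S.idx x) ⟨x, S.mem_idx x⟩) = γ.1 y := by
      rintro _ rfl
      exact hγc _
    exact Prod.ext (congrArg S.idx (hpγ γ y))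
      (deckGroup_ext hp ((h1 (p y) (hpγ γ y)).trans (congrArg γ.1 (hγc y)).symm))
  · intro v w x hv hw γ
    refine ⟨γ.1 (s v ⟨x, hv⟩), hmem v γ x hv, ?_⟩
    have h1 := hmem w (γ * (g v w)⁻¹) x hw
    rw [← hg v w x hv hw] at h1
    have h2 : (γ * (g v w)⁻¹).1 ((g v w).1 (s v ⟨x, hv⟩)) =
        (γ * (g v w)⁻¹ * g v w).1 (s v ⟨x, hv⟩) := rfl
    rwa [h2, inv_mul_cancel_right] at h1

end DeckGroup

open SingularChains

/-! ### From twisted cocycles to equivariant maps on homology -/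

section Occurrence

variable (F : Type u) [Field F]

/-- A functional on chains that vanishes on cycles is a difference of a function at the ends. -/
lemma exists_primitive_of_comp_homologyToClass_eq_zero {Y : Type u} [TopologicalSpace Y]
    [PathConnectedSpace Y] {V : Type v} [AddCommGroup V] [Module F V]
    (Φ : ChainClass F Y →ₗ[F] V) (h : Φ ∘ₗ homologyToClass F Y = 0) :
    ∃ f : Y → V, ∀ σ : C(stdSimplex ℝ (Fin 2), Y), Φ (cls F σ) = f (vtx σ 1) - f (vtx σ 0) := by
  obtain ⟨y0⟩ := (inferInstance : Nonempty Y)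
  let σ (y : Y) : C(stdSimplex ℝ (Fin 2), Y) :=
    (PathConnectedSpace.somePath y0 y : C(unitInterval, Y)).comp
      (stdSimplexHomeomorphUnitInterval : C(stdSimplex ℝ (Fin 2), unitInterval))
  have h0 (y) : vtx (σ y) 0 = y0 := by
    change (PathConnectedSpace.somePath y0 y) (stdSimplexHomeomorphUnitInterval _) = _
    rw [stdSimplexHomeomorphUnitInterval_zero]
    simp
  have h1 (y) : vtx (σ y) 1 = y := by
    change (PathConnectedSpace.somePath y0 y) (stdSimplexHomeomorphUnitInterval _) = _
    rw [stdSimplexHomeomorphUnitInterval_one]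
    simp
  refine ⟨fun y => Φ (cls F (σ y)), fun τ => ?_⟩
  -- Out from the base point to the start of `τ`, along `τ`, and back from its end: a cycle, on
  -- which `Φ` vanishes.
  obtain ⟨x, hx⟩ := exists_homology_of_cycle F
    (Finsupp.single (σ (vtx τ 0)) 1 + Finsupp.single τ 1 - Finsupp.single (σ (vtx τ 1)) 1) (by
      simp only [bdry, map_add, map_sub, Finsupp.linearCombination_single, one_smul, h0, h1]
      abel)
  have h2 := LinearMap.congr_fun h x
  rw [LinearMap.comp_apply, hx] at h2
  simp only [map_add, map_sub, Finsupp.linearCombination_single, one_smul,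
    LinearMap.zero_apply] at h2
  rw [sub_eq_zero] at h2
  beta_reduce
  rw [← h2]
  abel

/-- If all periods of a cocycle on the nerve of a star cover vanish, it is a coboundary. -/
lemma StarCover.exists_coboundary {ι : Type*} {Y : Type u} [TopologicalSpace Y]
    [PathConnectedSpace Y] (S : StarCover ι Y) {c : Y → ι} (hc : ∀ y, y ∈ S.U (c y))
    {V : Type v} [AddCommGroup V] [Module F V] {ε : ι → ι → V}
    (hε : ∀ i j k y, y ∈ S.U i → y ∈ S.U j → y ∈ S.U k → ε i j + ε j k = ε i k)
    (Φ : ChainClass F Y →ₗ[F] V) (hΦ : ∀ (f : C(stdSimplex ℝ (Fin 2), Y)) (h : _ → V),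
      IsPotential c ε f h → Φ (cls F f) = h (stdSimplex.vertex 1) - h (stdSimplex.vertex 0))
    (h : Φ ∘ₗ homologyToClass F Y = 0) :
    ∃ b : ι → V, ∀ i j y, y ∈ S.U i → y ∈ S.U j → ε i j = b j - b i := by
  classical
  obtain ⟨f, hf⟩ := exists_primitive_of_comp_homologyToClass_eq_zero F Φ h
  -- Along a path inside `U i` the function `ε i (c ·)` is a primitive, so it has the same
  -- increments as `f`; the constant difference becomes `b i`.
  have hconst (i : ι) (y y' : Y) (hy : y ∈ S.U i) (hy' : y' ∈ S.U i) :
      f y - ε i (c y) = f y' - ε i (c y') := by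
    obtain ⟨α, hα⟩ := S.joinedIn i i y y' ⟨hy, hy⟩ ⟨hy', hy'⟩
    let σ : C(stdSimplex ℝ (Fin 2), Y) := (α : C(unitInterval, Y)).comp
      (stdSimplexHomeomorphUnitInterval : C(stdSimplex ℝ (Fin 2), unitInterval))
    have h0 : σ (stdSimplex.vertex 0) = y := by
      change α (stdSimplexHomeomorphUnitInterval _) = _
      rw [stdSimplexHomeomorphUnitInterval_zero]
      simp
    have h1 : σ (stdSimplex.vertex 1) = y' := by
      change α (stdSimplexHomeomorphUnitInterval _) = _
      rw [stdSimplexHomeomorphUnitInterval_one]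
      simp
    have hσ (t) : σ t ∈ S.U i := (hα _).1
    have hpot : IsPotential c ε σ fun t => ε i (c (σ t)) := by
      intro t
      have : ∀ᶠ s in 𝓝 t, σ s ∈ S.U (c (σ t)) :=
        σ.continuous.continuousAt.eventually_mem ((S.isOpen_U _).mem_nhds (hc _))
      filter_upwards [this] with s hs
      rw [hε _ _ _ (σ s) (hσ s) hs (hc _)]
    have h2 := hΦ σ _ hpot
    rw [hf] at h2
    simp only [vtx, h0, h1] at h2
    rw [sub_eq_sub_iff_add_eq_add] at h2 ⊢
    rw [add_comm (f y), add_comm (f y'), ← h2, add_comm]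
  have hb : ∀ i, ∃ b, ∀ y ∈ S.U i, b = f y - ε i (c y) := by
    intro i
    by_cases hne : ∃ y, y ∈ S.U i
    · obtain ⟨y, hy⟩ := hne
      exact ⟨_, fun y' hy' => hconst i y y' hy hy'⟩
    · exact ⟨0, fun y hy => absurd ⟨y, hy⟩ hne⟩
  choose b hb using hb
  refine ⟨b, fun i j y hi hj => ?_⟩
  rw [hb i y hi, hb j y hj, ← hε i j _ y hi hj (hc y)]
  abel

variable [CharZero F] {X : Type*} {X' : Type u} [TopologicalSpace X] [TopologicalSpace X'] {p : X' → X}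

/-- A twisted cocycle on the nerve of a star cover of the base of a finite regular covering, with
values in a representation of the deck group, that is not a coboundary, gives a nonzero equivariant
map from the homology of the total space to the representation. -/
theorem exists_equivariant_map_ne_zero {ι : Type*} (hp : IsFiniteRegularCover p)
    (hsurj : Function.Surjective p) (S : StarCover ι X) :
    ∃ g : ι → ι → deckGroup p,
      (∀ v w u x, x ∈ S.U v → x ∈ S.U w → x ∈ S.U u → g w u * g v w = g v u) ∧
      ∀ (V : Type v) [AddCommGroup V] [Module F V] (ρ : Representation F (deckGroup p) V)
        (ε : ι → ι → V),
        (∀ v w u x, x ∈ S.U v → x ∈ S.U w → x ∈ S.U u →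
          ε v w + ρ (g v w)⁻¹ (ε w u) = ε v u) →
        (¬ ∃ b : ι → V, ∀ v w, (S.U v ∩ S.U w).Nonempty →
          ε v w = ρ (g v w)⁻¹ (b w) - b v) →
        ∃ T : H1 F X' →ₗ[F] V, T ≠ 0 ∧
          ∀ (γ : deckGroup p) x, T (homologyRep F X' γ.1 x) = ρ γ (T x) := by
  classical
  have := finite_deckGroup hp
  have := Fintype.ofFinite (deckGroup p)
  have := hp.pathConnected
  obtain ⟨g, S', c, hg, hc, hcγ, hpS, hmeet, hlift⟩ := exists_lifted_starCover hp hsurj S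
  refine ⟨g, hg, fun V _ _ ρ ε hε hcob => ?_⟩
  -- The sheet label absorbs the twist: where `a` and `b` meet, `b.2 = a.2 * (g a.1 b.1)⁻¹`, which
  -- turns the twisted rule for `ε` into the ordinary cocycle rule.
  let ε' : ι × deckGroup p → ι × deckGroup p → V := fun a b => ρ a.2 (ε a.1 b.1)
  have hε' (i j k y) (hi : y ∈ S'.U i) (hj : y ∈ S'.U j) (hk : y ∈ S'.U k) :
      ε' i j + ε' j k = ε' i k := by
    have h1 : j.2 = i.2 * (g i.1 j.1)⁻¹ := by rw [← hmeet i j y hi hj, mul_inv_cancel_right]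
    simp only [ε']
    rw [h1, map_mul, Module.End.mul_apply, ← map_add,
      hε _ _ _ (p y) (hpS _ _ hi) (hpS _ _ hj) (hpS _ _ hk)]
  obtain ⟨Φ, hΦ⟩ := exists_period F S'.isOpen_U hc hε'
  refine ⟨Φ ∘ₗ homologyToClass F X', fun h0 => hcob ?_, fun γ x => ?_⟩
  · obtain ⟨b, hb⟩ := S'.exists_coboundary F hc hε' Φ hΦ h0
    have hcard : (Fintype.card (deckGroup p) : F) ≠ 0 := Nat.cast_ne_zero.2 Fintype.card_ne_zero
    -- Moving each value back to the identity sheet and averaging over the deck group descends the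
    -- coboundary; division by the order uses characteristic zero.
    let B (v : ι) : V := ∑ γ : deckGroup p, ρ γ⁻¹ (b (v, γ))
    refine ⟨fun v => (Fintype.card (deckGroup p) : F)⁻¹ • B v, fun v w ⟨x, hv, hw⟩ => ?_⟩
    have hterm (γ : deckGroup p) :
        ε v w = ρ γ⁻¹ (b (w, γ * (g v w)⁻¹)) - ρ γ⁻¹ (b (v, γ)) := by
      obtain ⟨y, h1, h2⟩ := hlift v w x hv hw γ
      have h3 := hb _ _ y h1 h2
      rw [← map_sub, ← h3]
      change _ = (ρ γ⁻¹) (ρ γ (ε v w))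
      rw [← Module.End.mul_apply, ← map_mul, inv_mul_cancel, map_one, Module.End.one_apply]
    have hsum : (Fintype.card (deckGroup p) : F) • ε v w = ρ (g v w)⁻¹ (B w) - B v := by
      have h1 : ∑ _γ : deckGroup p, ε v w = (Fintype.card (deckGroup p) : F) • ε v w := by
        rw [Finset.sum_const, Finset.card_univ, Nat.cast_smul_eq_nsmul]
      rw [← h1, Finset.sum_congr rfl fun γ _ => hterm γ, Finset.sum_sub_distrib]
      congr 1
      simp only [B, map_sum]
      refine Fintype.sum_equiv (Equiv.mulRight (g v w)⁻¹) _ _ fun γ => ?_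
      rw [← Module.End.mul_apply, ← map_mul]
      simp
    rw [map_smul, ← smul_sub, ← hsum, inv_smul_smul₀ hcard]
  · obtain ⟨z, -, hz⟩ := exists_cycle F x
    simp only [LinearMap.comp_apply]
    rw [homologyToClass_homologyRep F γ.1 x z hz, hz, Finsupp.apply_linearCombination,
      Finsupp.apply_linearCombination, Finsupp.apply_linearCombination]
    congr 2
    ext1 f
    simp only [Function.comp_apply]
    obtain ⟨h, hh⟩ := exists_isPotential_simplex S'.isOpen_U hc hε' f
    -- As `c` is equivariant, translating a path by `γ` applies `ρ γ` to the cocycle values along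
    -- it, hence to its primitive.
    have hh' : IsPotential c ε' ((γ.1 : C(X', X')).comp f) fun t => ρ γ (h t) := by
      intro t
      filter_upwards [hh t] with s hs
      rw [hs, map_add]
      congr 1
      simp only [ContinuousMap.comp_apply, ε']
      change _ = ρ (c (γ.1 (f t))).2 (ε (c (γ.1 (f t))).1 (c (γ.1 (f s))).1)
      rw [hcγ, hcγ, map_mul, Module.End.mul_apply]
    rw [hΦ _ _ hh', hΦ _ _ hh, map_sub]

end Occurrence

/-! ### Twisted cochains on the nerve and the dimension count -/

section Twisted

variable {ι X G F V : Type*} [Fintype ι] [LinearOrder ι] [TopologicalSpace X] [Group G] [Field F]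
  [AddCommGroup V] [Module F V]

namespace StarCover

open Classical in
/-- The ordered edges of the nerve. -/
noncomputable def edges (S : StarCover ι X) : Finset (ι × ι) :=
  Finset.univ.filter fun e => e.1 < e.2 ∧ (S.U e.1 ∩ S.U e.2).Nonempty

open Classical in
/-- The ordered triangles of the nerve. -/
noncomputable def triangles (S : StarCover ι X) : Finset (ι × ι × ι) :=
  Finset.univ.filter fun t => t.1 < t.2.1 ∧ t.2.1 < t.2.2 ∧
    (S.U t.1 ∩ S.U t.2.1 ∩ S.U t.2.2).Nonempty

lemma mem_edges {S : StarCover ι X} {v w : ι} :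
    (v, w) ∈ S.edges ↔ v < w ∧ (S.U v ∩ S.U w).Nonempty := by
  simp [edges]

lemma mem_triangles {S : StarCover ι X} {v w u : ι} :
    (v, w, u) ∈ S.triangles ↔ v < w ∧ w < u ∧ (S.U v ∩ S.U w ∩ S.U u).Nonempty := by
  simp [triangles]

variable (S : StarCover ι X) (g : ι → ι → G) (ρ : Representation F G V)

open Classical in
/-- The alternating extension of a twisted cochain. -/
noncomputable def altExt : (S.edges → V) →ₗ[F] (ι → ι → V) where
  toFun ε v w := if h : (v, w) ∈ S.edges then ε ⟨_, h⟩ else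
    if h : (w, v) ∈ S.edges then -ρ (g v w)⁻¹ (ε ⟨_, h⟩) else 0
  map_add' a b := by
    ext v w
    simp only [Pi.add_apply]
    split_ifs
    · rfl
    · rw [map_add]; abel
    · simp
  map_smul' r a := by
    ext v w
    simp only [Pi.smul_apply, RingHom.id_apply]
    split_ifs <;> simp

variable {S g}

lemma altExt_of_mem (ε : S.edges → V) {v w : ι} (h : (v, w) ∈ S.edges) :
    S.altExt g ρ ε v w = ε ⟨_, h⟩ := by
  simp [altExt, h]

lemma altExt_self (ε : S.edges → V) (v : ι) : S.altExt g ρ ε v v = 0 := by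
  have h : (v, v) ∉ S.edges := by simp [mem_edges]
  simp [altExt, h]

/-- The transition elements of a covering over a star cover satisfy the cocycle rule. -/
def IsTransition (S : StarCover ι X) (g : ι → ι → G) : Prop :=
  ∀ v w u x, x ∈ S.U v → x ∈ S.U w → x ∈ S.U u → g w u * g v w = g v u

omit [Fintype ι] [LinearOrder ι] in
lemma IsTransition.self (hg : IsTransition S g) {v : ι} {x : X} (hx : x ∈ S.U v) : g v v = 1 := by
  simpa using hg v v v x hx hx hx

omit [Fintype ι] [LinearOrder ι] in
lemma IsTransition.inv (hg : IsTransition S g) {v w : ι} {x : X} (hv : x ∈ S.U v)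
    (hw : x ∈ S.U w) : (g w v)⁻¹ = g v w := by
  rw [inv_eq_iff_mul_eq_one, hg v w v x hv hw hv, hg.self hv]

lemma altExt_add_swap (hg : IsTransition S g) (ε : S.edges → V) {v w : ι} {x : X}
    (hv : x ∈ S.U v) (hw : x ∈ S.U w) :
    S.altExt g ρ ε v w + ρ (g v w)⁻¹ (S.altExt g ρ ε w v) = 0 := by
  rcases lt_trichotomy v w with h | rfl | h
  · have h1 : (v, w) ∈ S.edges := mem_edges.2 ⟨h, x, hv, hw⟩
    have h2 : (w, v) ∉ S.edges := fun h' => lt_asymm h (mem_edges.1 h').1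
    simp only [altExt, LinearMap.coe_mk, AddHom.coe_mk, h1, h2, dif_pos, dif_neg,
      not_false_eq_true]
    rw [map_neg, ← Module.End.mul_apply, ← map_mul, ← mul_inv_rev, hg v w v x hv hw hv,
      hg.self hv]
    simp
  · simp [altExt_self]
  · have h1 : (w, v) ∈ S.edges := mem_edges.2 ⟨h, x, hw, hv⟩
    have h2 : (v, w) ∉ S.edges := fun h' => lt_asymm h (mem_edges.1 h').1
    simp only [altExt, LinearMap.coe_mk, AddHom.coe_mk, h1, h2, dif_pos, dif_neg,
      not_false_eq_true]
    simp

/-- The rule is imposed on increasing triples only. It is stable under adjacent transpositions of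
the indices (`swap12`, `swap23`) and automatic when two of them coincide, so it holds for all
triples with a common point. -/
lemma altExt_cocycle (hg : IsTransition S g) (ε : S.edges → V)
    (hε : ∀ v w u, (v, w, u) ∈ S.triangles → S.altExt g ρ ε v w +
      ρ (g v w)⁻¹ (S.altExt g ρ ε w u) = S.altExt g ρ ε v u)
    (v w u : ι) (x : X) (hv : x ∈ S.U v) (hw : x ∈ S.U w) (hu : x ∈ S.U u) :
    S.altExt g ρ ε v w + ρ (g v w)⁻¹ (S.altExt g ρ ε w u) = S.altExt g ρ ε v u := by
  set e := S.altExt g ρ ε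
  let Z (v w u : ι) : Prop := e v w + ρ (g v w)⁻¹ (e w u) = e v u
  have hswap (a b : ι) (ha : x ∈ S.U a) (hb : x ∈ S.U b) : e a b = -ρ (g a b)⁻¹ (e b a) :=
    eq_neg_of_add_eq_zero_left (altExt_add_swap ρ hg ε ha hb)
  have swap12 (a b c : ι) (ha : x ∈ S.U a) (hb : x ∈ S.U b) (h : Z a b c) : Z b a c := by
    simp only [Z] at h ⊢
    rw [← h, map_add, ← Module.End.mul_apply (ρ _) (ρ _), ← map_mul, hg.inv ha hb,
      mul_inv_cancel, map_one, Module.End.one_apply, hswap b a hb ha, hg.inv ha hb]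
    abel
  have swap23 (a b c : ι) (ha : x ∈ S.U a) (hb : x ∈ S.U b) (hc : x ∈ S.U c) (h : Z a b c) :
      Z a c b := by
    simp only [Z] at h ⊢
    rw [← h, hswap b c hb hc, map_neg, ← Module.End.mul_apply (ρ _) (ρ _), ← map_mul,
      ← mul_inv_rev, hg a b c x ha hb hc]
    abel
  have sorted (a b c : ι) (ha : x ∈ S.U a) (hb : x ∈ S.U b) (hc : x ∈ S.U c) (hab : a < b)
      (hbc : b < c) : Z a b c := hε a b c (mem_triangles.2 ⟨hab, hbc, x, ⟨ha, hb⟩, hc⟩)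
  have deg23 (a b : ι) : Z a b b := by simp [Z, e, altExt_self]
  have deg12 (a b : ι) (ha : x ∈ S.U a) : Z a a b := by simp [Z, e, altExt_self, hg.self ha]
  have deg13 (a b : ι) (ha : x ∈ S.U a) (hb : x ∈ S.U b) : Z a b a := by
    simp only [Z, e]
    rw [altExt_add_swap ρ hg ε ha hb, altExt_self]
  change Z v w u
  rcases lt_trichotomy v w with h1 | rfl | h1
  · rcases lt_trichotomy w u with h2 | rfl | h2
    · exact sorted _ _ _ hv hw hu h1 h2
    · exact deg23 _ _
    · rcases lt_trichotomy v u with h3 | rfl | h3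
      · exact swap23 _ _ _ hv hu hw (sorted _ _ _ hv hu hw h3 h2)
      · exact deg13 _ _ hv hw
      · exact swap23 _ _ _ hv hu hw (swap12 _ _ _ hu hv (sorted _ _ _ hu hv hw h3 h1))
  · exact deg12 _ _ hv
  · rcases lt_trichotomy v u with h2 | rfl | h2
    · exact swap12 _ _ _ hw hv (sorted _ _ _ hw hv hu h1 h2)
    · exact deg13 _ _ hv hw
    · rcases lt_trichotomy w u with h3 | rfl | h3
      · exact swap12 _ _ _ hw hv (swap23 _ _ _ hw hu hv (sorted _ _ _ hw hu hv h3 h2))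
      · exact deg23 _ _
      · exact swap12 _ _ _ hw hv
          (swap23 _ _ _ hw hu hv (swap12 _ _ _ hu hw (sorted _ _ _ hu hw hv h3 h1)))

/-- If the nerve has negative Euler characteristic, then there is a twisted cocycle that is not a
coboundary. -/
theorem exists_twisted_cocycle [FiniteDimensional F V] [Nontrivial V] (hg : IsTransition S g)
    (hcard : Fintype.card ι + S.triangles.card < S.edges.card) :
    ∃ ε : ι → ι → V,
      (∀ v w u x, x ∈ S.U v → x ∈ S.U w → x ∈ S.U u →
        ε v w + ρ (g v w)⁻¹ (ε w u) = ε v u) ∧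
      ¬ ∃ b : ι → V, ∀ v w, (S.U v ∩ S.U w).Nonempty → ε v w = ρ (g v w)⁻¹ (b w) - b v := by
  let δ : (S.edges → V) →ₗ[F] (S.triangles → V) :=
    { toFun := fun ε t => S.altExt g ρ ε t.1.1 t.1.2.1 +
        ρ (g t.1.1 t.1.2.1)⁻¹ (S.altExt g ρ ε t.1.2.1 t.1.2.2) - S.altExt g ρ ε t.1.1 t.1.2.2
      map_add' := fun a b => by
        ext t
        simp only [map_add, Pi.add_apply]
        abel
      map_smul' := fun r a => by
        ext t
        simp only [map_smul, Pi.smul_apply, RingHom.id_apply, smul_sub, smul_add] }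
  let B : (ι → V) →ₗ[F] (S.edges → V) :=
    { toFun := fun b e => ρ (g e.1.1 e.1.2)⁻¹ (b e.1.2) - b e.1.1
      map_add' := fun a b => by
        ext t
        simp only [map_add, Pi.add_apply]
        abel
      map_smul' := fun r a => by
        ext t
        simp only [map_smul, Pi.smul_apply, RingHom.id_apply, smul_sub] }
  -- With d the dimension of `V`, rank-nullity bounds the kernel below by (edges - triangles)·d, and
  -- the range of `B` has dimension at most (vertices)·d.
  have hnot : ¬ LinearMap.ker δ ≤ LinearMap.range B := by
    intro hle
    have h1 := δ.finrank_range_add_finrank_ker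
    have h2 := Submodule.finrank_mono hle
    have h3 := B.finrank_range_le
    have h4 := (LinearMap.range δ).finrank_le
    simp only [Module.finrank_pi_fintype, Finset.sum_const, Finset.card_univ, smul_eq_mul,
      Fintype.card_coe] at h1 h3 h4
    have hd : 0 < Module.finrank F V := Module.finrank_pos
    have h5 : S.edges.card * Module.finrank F V ≤
        (Fintype.card ι + S.triangles.card) * Module.finrank F V := by
      rw [add_mul]; omega
    exact absurd (Nat.le_of_mul_le_mul_right h5 hd) (not_le.2 hcard)
  obtain ⟨ε, hker, hran⟩ := Set.not_subset.1 hnot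
  refine ⟨S.altExt g ρ ε, altExt_cocycle ρ hg ε fun v w u ht => ?_, fun ⟨b, hb⟩ => hran ⟨b, ?_⟩⟩
  · exact sub_eq_zero.1 (congrFun (LinearMap.mem_ker.1 hker) ⟨_, ht⟩)
  · ext ⟨⟨v, w⟩, he⟩
    rw [← altExt_of_mem (g := g) ρ ε he]
    exact (hb v w (mem_edges.1 he).2).symm

end StarCover

end Twisted

/-! ### The star cover of a punctured triangulated surface -/

lemma IsCoveringMap.subset_range_of_joinedIn {X X' : Type*} [TopologicalSpace X]
    [TopologicalSpace X'] {p : X' → X} (hp : IsCoveringMap p) {s : Set X} {y : X'} {x : X}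
    (h : JoinedIn s (p y) x) : x ∈ Set.range p := by
  obtain ⟨α, -⟩ := h
  have hα : (α : C(unitInterval, X)) 0 = p y := α.source
  refine ⟨hp.liftPath α y hα 1, ?_⟩
  exact (congrFun (hp.liftPath_lifts α y hα) 1).trans α.target

lemma SimpleGraph.Reachable.of_adj_closed {V : Type*} {G : SimpleGraph V} {B : V → Prop}
    (h : ∀ a b, G.Adj a b → B a → B b) {a b : V} (r : G.Reachable a b) (ha : B a) : B b := by
  obtain ⟨w⟩ := r
  induction w with
  | nil => exact ha
  | cons hadj _ ih => exact ih (h _ _ hadj ha)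

namespace ClosedTriangulation

variable {ι : Type*} [DecidableEq ι]

/-- The midpoint of two vertices, in barycentric coordinates. -/
noncomputable def mid (v w : ι) : ι → ℝ := (1 / 2 : ℝ) • (Pi.single v 1 + Pi.single w 1)

lemma mid_nonneg (v w i : ι) : 0 ≤ mid v w i := by
  simp only [mid, Pi.smul_apply, Pi.add_apply, Pi.single_apply, smul_eq_mul]
  split_ifs <;> norm_num

lemma mid_sum [Fintype ι] (v w : ι) : ∑ i, mid v w i = 1 := by
  simp only [mid, Pi.smul_apply, Pi.add_apply, smul_eq_mul]
  rw [← Finset.mul_sum, Finset.sum_add_distrib]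
  simp
  norm_num

lemma mid_left_pos (v w : ι) : 0 < mid v w v := by
  simp only [mid, Pi.smul_apply, Pi.add_apply, Pi.single_apply, smul_eq_mul]
  split_ifs <;> norm_num at *

lemma mid_right_pos (v w : ι) : 0 < mid v w w := by
  simp only [mid, Pi.smul_apply, Pi.add_apply, Pi.single_apply, smul_eq_mul]
  split_ifs <;> norm_num at *

lemma eq_or_eq_of_mid_ne_zero {v w i : ι} (h : mid v w i ≠ 0) : i = v ∨ i = w := by
  by_contra hc
  push Not at hc
  exact h (by simp [mid, hc.1, hc.2])

variable [Fintype ι] {K : ClosedTriangulation ι} {P : Finset ι}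

lemma mem_puncturedRealization_of {z : ι → ℝ} {v : ι} (hv : v ∉ P) (h0 : ∀ i, 0 ≤ z i)
    (h1 : ∑ i, z i = 1) {t : Finset ι} (ht : t ∈ K.triangles) (hz : ∀ i, z i ≠ 0 → i ∈ t)
    (hzv : z v ≠ 0) : z ∈ K.puncturedRealization P := by
  refine ⟨h0, h1, ⟨t, ht, hz⟩, fun q hq hzq => hzv ?_⟩
  have : v ≠ q := fun h => hv (h ▸ hq)
  rw [hzq, Pi.single_eq_of_ne this]

lemma mid_mem {t : Finset ι} (ht : t ∈ K.triangles) {v w : ι} (hv : v ∉ P) (hvt : v ∈ t)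
    (hwt : w ∈ t) : mid v w ∈ K.puncturedRealization P :=
  mem_puncturedRealization_of hv (mid_nonneg v w) (mid_sum v w) ht
    (fun i hi => by rcases eq_or_eq_of_mid_ne_zero hi with rfl | rfl <;> assumption)
    (mid_left_pos v w).ne'

/-- The point `x` has `v` and `w` in its support, so any triangle carrying `x` carries the whole
segment to their midpoint. The positive coordinate at the non-puncture `v` keeps the segment away
from the punctures. -/
lemma combo_mem {x : ι → ℝ} (hx : x ∈ K.puncturedRealization P) {v w : ι} (hv : v ∉ P)
    (hxv : 0 < x v) (hxw : 0 < x w) {s : ℝ} (hs0 : 0 ≤ s) (hs1 : s ≤ 1) :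
    s • x + (1 - s) • mid v w ∈ K.puncturedRealization P ∧
      0 < (s • x + (1 - s) • mid v w) v ∧ 0 < (s • x + (1 - s) • mid v w) w := by
  obtain ⟨h0, h1, ⟨t, ht, hxt⟩, -⟩ := hx
  have hpos {i} (hi : 0 < x i) (hm : 0 < mid v w i) : 0 < (s • x + (1 - s) • mid v w) i := by
    simp only [Pi.add_apply, Pi.smul_apply, smul_eq_mul]
    rcases hs0.eq_or_lt with rfl | hs
    · simpa using hm
    · have := mul_pos hs hi
      have := mul_nonneg (sub_nonneg.2 hs1) hm.le
      linarith
  have hposv := hpos hxv (mid_left_pos v w)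
  refine ⟨mem_puncturedRealization_of hv (fun i => ?_) ?_ ht (fun i hi => ?_) hposv.ne', hposv,
    hpos hxw (mid_right_pos v w)⟩
  · simp only [Pi.add_apply, Pi.smul_apply, smul_eq_mul]
    exact add_nonneg (mul_nonneg hs0 (h0 i)) (mul_nonneg (sub_nonneg.2 hs1) (mid_nonneg v w i))
  · simp only [Pi.add_apply, Pi.smul_apply, smul_eq_mul]
    rw [Finset.sum_add_distrib, ← Finset.mul_sum, ← Finset.mul_sum, h1, mid_sum]
    ring
  · by_contra hit
    have hxi : x i = 0 := by
      by_contra h; exact hit (hxt i h)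
    have hmi : mid v w i = 0 := by
      by_contra h
      rcases eq_or_eq_of_mid_ne_zero h with rfl | rfl
      · exact hxv.ne' hxi
      · exact hxw.ne' hxi
    exact hi (by simp [hxi, hmi])

lemma joined_mid {v w : ι} (hv : v ∉ P) (x : K.puncturedRealization P) (hxv : 0 < x.1 v)
    (hxw : 0 < x.1 w) (h : mid v w ∈ K.puncturedRealization P) :
    JoinedIn {x : K.puncturedRealization P | 0 < x.1 v ∧ 0 < x.1 w} ⟨mid v w, h⟩ x := by
  have key (s : unitInterval) := combo_mem x.2 hv hxv hxw s.2.1 s.2.2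
  refine ⟨⟨⟨fun s => ⟨s.1 • x.1 + (1 - s.1) • mid v w, (key s).1⟩, by fun_prop⟩, ?_, ?_⟩,
    fun s => ?_⟩
  · ext; simp
  · ext; simp
  · exact (key s).2

/-- The cover of the punctured realization by the open stars of the vertices that are not
punctures. -/
noncomputable def starCover (K : ClosedTriangulation ι) (P : Finset ι)
    (hP : ∀ t ∈ K.triangles, (t ∩ P).card ≤ 1) :
    StarCover {v // v ∉ P} (K.puncturedRealization P) where
  U v := {x | 0 < x.1 v.1}
  isOpen_U v := isOpen_lt continuous_const
    ((continuous_apply v.1).comp continuous_subtype_val)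
  exists_mem x := by
    obtain ⟨h0, h1, ⟨t, ht, hxt⟩, hx⟩ := x.2
    by_contra hc
    push Not at hc
    have hz (i) (hi : i ∉ P) : x.1 i = 0 := le_antisymm (not_lt.1 (hc ⟨i, hi⟩)) (h0 i)
    obtain ⟨q, hq⟩ : ∃ q, x.1 q ≠ 0 := by
      by_contra hall
      push Not at hall
      simp [hall] at h1
    -- A point outside all stars is supported on punctures of one triangle; there is at most one of
    -- these, so the point would be a removed vertex.
    have hqP : q ∈ P := by
      by_contra h; exact hq (hz q h)
    have hother (i) (hi : i ≠ q) : x.1 i = 0 := by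
      by_contra h
      have hiP : i ∈ P := by
        by_contra h'; exact h (hz i h')
      exact hi (Finset.card_le_one.1 (hP t ht) i (Finset.mem_inter.2 ⟨hxt i h, hiP⟩) q
        (Finset.mem_inter.2 ⟨hxt q hq, hqP⟩))
    refine hx q hqP (funext fun i => ?_)
    by_cases hi : i = q
    · subst hi
      rw [Pi.single_eq_same, ← h1, Finset.sum_eq_single i (fun j _ hj => hother j hj) (by simp)]
    · rw [hother i hi, Pi.single_eq_of_ne hi]
  -- Straight-line contraction to the vertex, which is `mid v v`; `projIcc` clamps the real
  -- parameter to the unit interval.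
  contr v := ⟨fun q => ⟨⟨_, (combo_mem q.2.1.2 v.2 q.2.2 q.2.2
      (Set.projIcc (0 : ℝ) 1 zero_le_one q.1).2.1 (Set.projIcc (0 : ℝ) 1 zero_le_one q.1).2.2).1⟩,
      (combo_mem q.2.1.2 v.2 q.2.2 q.2.2 (Set.projIcc (0 : ℝ) 1 zero_le_one q.1).2.1
        (Set.projIcc (0 : ℝ) 1 zero_le_one q.1).2.2).2.1⟩, by fun_prop⟩
  contr_zero v x y := by
    refine Subtype.ext (Subtype.ext ?_)
    simp
  contr_one v x := by
    refine Subtype.ext (Subtype.ext ?_)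
    simp
  joinedIn v w x y hx hy := by
    obtain ⟨-, -, ⟨t, ht, hxt⟩, -⟩ := x.2
    have h := mid_mem ht v.2 (hxt _ hx.1.ne') (hxt _ hx.2.ne')
    exact (joined_mid v.2 x hx.1 hx.2 h).symm.trans (joined_mid v.2 y hy.1 hy.2 h)

variable {hP : ∀ t ∈ K.triangles, (t ∩ P).card ≤ 1}

lemma mid_mem_starCover {t : Finset ι} (ht : t ∈ K.triangles) {v w : ι} (hv : v ∉ P)
    (hw : w ∉ P) (hvt : v ∈ t) (hwt : w ∈ t) :
    ((K.starCover P hP).U ⟨v, hv⟩ ∩ (K.starCover P hP).U ⟨w, hw⟩).Nonempty :=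
  ⟨⟨mid v w, mid_mem ht hv hvt hwt⟩, mid_left_pos v w, mid_right_pos v w⟩

/-- A covering with nonempty total space of a punctured surface is surjective. -/
lemma surjective_of_isCoveringMap (hP : ∀ t ∈ K.triangles, (t ∩ P).card ≤ 1)
    {X' : Type*} [TopologicalSpace X'] [Nonempty X'] {p : X' → K.puncturedRealization P}
    (hp : IsCoveringMap p) : Function.Surjective p := by
  classical
  let S := K.starCover P hP
  let A (v : {v // v ∉ P}) : Prop := ∃ y, p y ∈ S.U v
  have hA {v} (hv : A v) {x} (hx : x ∈ S.U v) : x ∈ Set.range p := by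
    obtain ⟨y, hy⟩ := hv
    exact hp.subset_range_of_joinedIn (S.joinedIn v v _ x ⟨hy, hy⟩ ⟨hx, hx⟩)
  have hstep {t : Finset ι} (ht : t ∈ K.triangles) {v w : ι} (hv : v ∉ P) (hw : w ∉ P)
      (hvt : v ∈ t) (hwt : w ∈ t) (h : A ⟨v, hv⟩) : A ⟨w, hw⟩ := by
    obtain ⟨x, hxv, hxw⟩ := mid_mem_starCover (hP := hP) ht hv hw hvt hwt
    obtain ⟨y, rfl⟩ := hA h hxv
    exact ⟨y, hxw⟩
  have hlink {q a : ι} (hq : q ∈ P) (ha : a ≠ q) {t} (ht : t ∈ K.triangles) (hqt : q ∈ t)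
      (hat : a ∈ t) : a ∉ P := fun haP => ha (Finset.card_le_one.1 (hP t ht) a
        (Finset.mem_inter.2 ⟨hat, haP⟩) q (Finset.mem_inter.2 ⟨hqt, hq⟩))
  -- An edge path may run through a puncture, which has no star. For a puncture the predicate
  -- instead asks that all its non-puncture neighbours be reached, which follows from one of them
  -- because the link is connected and contains no puncture.
  let B (v : ι) : Prop := (∀ h : v ∉ P, A ⟨v, h⟩) ∧
    (v ∈ P → ∀ w, w ≠ v → ∀ t ∈ K.triangles, v ∈ t → w ∈ t → ∀ h : w ∉ P, A ⟨w, h⟩)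
  have hadj : ∀ v w, v ≠ w → (∃ t ∈ K.triangles, v ∈ t ∧ w ∈ t) → B v → B w := by
    rintro v w hvw ⟨t, ht, hvt, hwt⟩ ⟨h1, h2⟩
    by_cases hv : v ∈ P
    · have hw : w ∉ P := hlink hv hvw.symm ht hvt hwt
      exact ⟨fun h => h2 hv w hvw.symm t ht hvt hwt h, fun h => absurd h hw⟩
    · refine ⟨fun hw => hstep ht hv hw hvt hwt (h1 hv), fun hw a ha t' ht' hwt' hat' haP => ?_⟩
      let T := {a : ι // a ≠ w ∧ ∃ t ∈ K.triangles, w ∈ t ∧ a ∈ t}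
      have hr := (K.link_connected w).preconnected ⟨v, hvw, t, ht, hwt, hvt⟩
        ⟨a, ha, t', ht', hwt', hat'⟩
      refine hr.of_adj_closed (B := fun b : T => ∀ h : b.1 ∉ P, A ⟨b.1, h⟩) ?_ (fun h => h1 h) haP
      rintro b c hbc hb hc
      have hbP : b.1 ∉ P := by
        obtain ⟨hbw, t, ht, hwt, hbt⟩ := b.2
        exact hlink hw hbw ht hwt hbt
      rw [SimpleGraph.fromRel_adj] at hbc
      rcases hbc.2 with h | h
      · exact hstep h hbP hc (by simp) (by simp) (hb hbP)
      · exact hstep h hbP hc (by simp) (by simp) (hb hbP)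
  have hB : ∀ v, B v := by
    obtain ⟨y⟩ := (inferInstance : Nonempty X')
    obtain ⟨v, hv⟩ := S.exists_mem (p y)
    intro w
    refine (K.connected.preconnected v.1 w).of_adj_closed (B := B) ?_
      ⟨fun h => ⟨y, hv⟩, fun h => absurd h v.2⟩
    intro a b hab
    rw [SimpleGraph.fromRel_adj] at hab
    refine hadj a b hab.1 ?_
    rcases hab.2 with h | ⟨t, h1, h2, h3⟩
    · exact h
    · exact ⟨t, h1, h3, h2⟩
  intro x
  obtain ⟨v, hv⟩ := S.exists_mem x
  exact hA ((hB v.1).1 v.2) hv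

/-! ### Counting simplices -/

/-- Double counting of incidences: an edge lies on two triangles, and a triangle that meets `P` has
exactly one puncture, hence exactly two edges through it. -/
lemma card_edges_filter_not_disjoint (hP : ∀ t ∈ K.triangles, (t ∩ P).card ≤ 1) :
    (K.edges.filter fun e => ¬ Disjoint e P).card =
      (K.triangles.filter fun t => ¬ Disjoint t P).card := by
  classical
  have h := Finset.sum_card_bipartiteAbove_eq_sum_card_bipartiteBelow
    (s := K.edges.filter fun e => ¬ Disjoint e P)
    (t := K.triangles.filter fun t => ¬ Disjoint t P) (fun e t => e ⊆ t)
  rw [Finset.sum_congr rfl (g := fun _ => 2), Finset.sum_congr (s₁ := K.triangles.filter _) rfl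
    (g := fun _ => 2)] at h
  · simpa using h
  · intro t ht
    obtain ⟨ht, htP⟩ := Finset.mem_filter.1 ht
    obtain ⟨q, hqt, hqP⟩ := Finset.not_disjoint_iff.1 htP
    have himg : Finset.bipartiteBelow (fun e t : Finset ι => e ⊆ t)
        (K.edges.filter fun e => ¬ Disjoint e P) t = (t.erase q).image fun a => {q, a} := by
      ext e
      simp only [Finset.mem_bipartiteBelow, Finset.mem_filter, edges, Finset.mem_powersetCard,
        Finset.mem_image, Finset.mem_erase]
      constructor
      · rintro ⟨⟨⟨⟨-, he⟩, -⟩, heP⟩, het⟩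
        obtain ⟨r, hre, hrP⟩ := Finset.not_disjoint_iff.1 heP
        have hrq : r = q := Finset.card_le_one.1 (hP t ht) r
          (Finset.mem_inter.2 ⟨het hre, hrP⟩) q (Finset.mem_inter.2 ⟨hqt, hqP⟩)
        subst hrq
        obtain ⟨a, b, hab, rfl⟩ := Finset.card_eq_two.1 he
        rcases Finset.mem_insert.1 hre with rfl | h
        · exact ⟨b, ⟨hab.symm, het (by simp)⟩, rfl⟩
        · rw [Finset.mem_singleton] at h
          subst h
          exact ⟨a, ⟨hab, het (by simp)⟩, Finset.pair_comm _ _⟩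
      · rintro ⟨a, ⟨haq, hat⟩, rfl⟩
        have hsub : {q, a} ⊆ t := by
          intro i hi
          simp only [Finset.mem_insert, Finset.mem_singleton] at hi
          rcases hi with rfl | rfl <;> assumption
        exact ⟨⟨⟨⟨Finset.subset_univ _, Finset.card_pair haq.symm⟩, t, ht, hsub⟩,
          Finset.not_disjoint_iff.2 ⟨q, by simp, hqP⟩⟩, hsub⟩
    rw [himg, Finset.card_image_of_injOn, Finset.card_erase_of_mem hqt, K.card_eq_three t ht]
    intro a ha b hb hab
    have hmem : a ∈ ({q, b} : Finset ι) := by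
      have : a ∈ ({q, a} : Finset ι) := by simp
      exact (show ({q, a} : Finset ι) = {q, b} from hab) ▸ this
    rcases Finset.mem_insert.1 hmem with h | h
    · exact absurd h (Finset.mem_erase.1 ha).1
    · exact Finset.mem_singleton.1 h
  · intro e he
    obtain ⟨he, heP⟩ := Finset.mem_filter.1 he
    obtain ⟨he, t, ht⟩ := Finset.mem_filter.1 he
    rw [← K.two_triangles e (Finset.mem_powersetCard.1 he).2 ⟨t, ht⟩]
    congr 1
    ext t
    simp only [Finset.mem_bipartiteAbove, Finset.mem_filter]
    refine ⟨fun h => ⟨h.1.1, h.2⟩, fun h => ⟨⟨h.1, fun hd => heP ?_⟩, h.2⟩⟩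
    exact Finset.disjoint_of_subset_left h.2 hd

variable {m : ℕ} {L : ClosedTriangulation (Fin m)} {Q : Finset (Fin m)}
  (hQ : ∀ t ∈ L.triangles, (t ∩ Q).card ≤ 1)

/-- The stars of the two ends of an edge meet at its midpoint. Only this inequality, and the
opposite one for triangles, is needed to bound the Euler characteristic of the nerve from above. -/
lemma card_le_card_edges_starCover :
    (L.edges.filter fun e => Disjoint e Q).card ≤ (L.starCover Q hQ).edges.card := by
  classical
  refine (Finset.card_le_card fun e he => ?_).trans
    (Finset.card_image_le (s := (L.starCover Q hQ).edges) (f := fun a => ({a.1.1, a.2.1} : Finset _)))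
  obtain ⟨he, heQ⟩ := Finset.mem_filter.1 he
  obtain ⟨he, t, ht, het⟩ := Finset.mem_filter.1 he
  obtain ⟨a, b, hab, rfl⟩ := Finset.card_eq_two.1 (Finset.mem_powersetCard.1 he).2
  have ha : a ∉ Q := Finset.disjoint_left.1 heQ (by simp)
  have hb : b ∉ Q := Finset.disjoint_left.1 heQ (by simp)
  have hat : a ∈ t := het (by simp)
  have hbt : b ∈ t := het (by simp)
  rw [Finset.mem_image]
  rcases hab.lt_or_gt with h | h
  · exact ⟨(⟨a, ha⟩, ⟨b, hb⟩), StarCover.mem_edges.2 ⟨h, mid_mem_starCover ht ha hb hat hbt⟩, rfl⟩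
  · exact ⟨(⟨b, hb⟩, ⟨a, ha⟩), StarCover.mem_edges.2 ⟨h, mid_mem_starCover ht hb ha hbt hat⟩,
      Finset.pair_comm _ _⟩

lemma card_triangles_starCover_le :
    (L.starCover Q hQ).triangles.card ≤ (L.triangles.filter fun t => Disjoint t Q).card := by
  classical
  refine Finset.card_le_card_of_injOn (fun a => {a.1.1, a.2.1.1, a.2.2.1}) ?_ ?_
  · rintro ⟨a, b, c⟩ habc
    obtain ⟨hab, hbc, x, ⟨hxa, hxb⟩, hxc⟩ := StarCover.mem_triangles.1 habc
    obtain ⟨-, -, ⟨t, ht, hxt⟩, -⟩ := x.2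
    have hcard : ({a.1, b.1, c.1} : Finset (Fin m)).card = 3 :=
      Finset.card_eq_three.2 ⟨_, _, _, fun h => hab.ne (Subtype.ext h),
        fun h => (hab.trans hbc).ne (Subtype.ext h), fun h => hbc.ne (Subtype.ext h), rfl⟩
    have hsub : ({a.1, b.1, c.1} : Finset (Fin m)) ⊆ t := by
      intro i hi
      simp only [Finset.mem_insert, Finset.mem_singleton] at hi
      rcases hi with rfl | rfl | rfl
      · exact hxt _ hxa.ne'
      · exact hxt _ hxb.ne'
      · exact hxt _ hxc.ne'
    have heq := Finset.eq_of_subset_of_card_le hsub (by rw [hcard, L.card_eq_three t ht])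
    simp only [Finset.coe_filter, Set.mem_ofPred_eq]
    refine ⟨heq ▸ ht, ?_⟩
    simp [Finset.disjoint_insert_left, a.2, b.2, c.2]
  · rintro ⟨a, b, c⟩ habc ⟨a', b', c'⟩ habc' h
    obtain ⟨h1, h2, -⟩ := StarCover.mem_triangles.1 habc
    obtain ⟨h3, h4, -⟩ := StarCover.mem_triangles.1 habc'
    obtain ⟨⟨a, _⟩, _⟩ := a
    obtain ⟨⟨b, _⟩, _⟩ := b
    obtain ⟨⟨c, _⟩, _⟩ := c
    obtain ⟨⟨a', _⟩, _⟩ := a'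
    obtain ⟨⟨b', _⟩, _⟩ := b'
    obtain ⟨⟨c', _⟩, _⟩ := c'
    simp only [Subtype.mk_lt_mk, Fin.mk_lt_mk] at h1 h2 h3 h4
    rw [Finset.ext_iff] at h
    simp only [Finset.mem_insert, Finset.mem_singleton] at h
    have e1 := (h ⟨a, by assumption⟩).1 (by simp)
    have e2 := (h ⟨b, by assumption⟩).1 (by simp)
    have e3 := (h ⟨c, by assumption⟩).1 (by simp)
    simp only [Fin.mk.injEq, Prod.mk.injEq, Subtype.mk.injEq] at e1 e2 e3 ⊢
    -- An increasing triple is determined by its underlying set.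
    omega

/-- The nerve of the star cover of a punctured surface of hyperbolic type has negative Euler
characteristic. -/
lemma card_add_card_triangles_lt {g n : ℕ} (hgn : 2 < 2 * g + n)
    (hχ : L.eulerChar = 2 - 2 * (g : ℤ)) (hn : Q.card = n) :
    Fintype.card {v // v ∉ Q} + (L.starCover Q hQ).triangles.card <
      (L.starCover Q hQ).edges.card := by
  have h1 := card_le_card_edges_starCover hQ
  have h2 := card_triangles_starCover_le hQ
  have h3 := card_edges_filter_not_disjoint hQ
  have h4 := Finset.card_filter_add_card_filter_not (s := L.edges) fun e => Disjoint e Q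
  have h5 := Finset.card_filter_add_card_filter_not (s := L.triangles) fun e => Disjoint e Q
  have h6 : Fintype.card {v // v ∉ Q} + Q.card = m := by
    rw [Fintype.card_subtype_compl, Fintype.card_coe, Fintype.card_fin]
    have := Finset.card_le_univ Q
    rw [Fintype.card_fin] at this
    omega
  -- By `h3` the edges and triangles at punctures cancel, so discarding the punctures and these
  -- simplices lowers the Euler characteristic by exactly n, to 2 - 2g - n.
  rw [eulerChar, Fintype.card_fin] at hχ
  omega

end ClosedTriangulation

open scoped MonoidAlgebra

/-! ### Representations of a finite group with a normalizing element -/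

section Algebra

/-- The orbit of a nonzero vector is finite, and its span is a nonzero subrepresentation, hence
everything. -/
lemma Representation.finiteDimensional_of_isIrreducible {F G V : Type*} [Field F] [Group G]
    [Finite G] [AddCommGroup V] [Module F V] (ρ : Representation F G V) (h : ρ.IsIrreducible) :
    FiniteDimensional F V ∧ Nontrivial V := by
  have hnt : Nontrivial V := by
    by_contra hV
    rw [not_nontrivial_iff_subsingleton] at hV
    have := h.toNontrivial
    exact bot_ne_top (α := Subrepresentation ρ)
      (Subrepresentation.toSubmodule_injective (Subsingleton.elim _ _))
  obtain ⟨v, hv⟩ := exists_ne (0 : V)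
  let W : Subrepresentation ρ :=
    { toSubmodule := Submodule.span F (Set.range fun g => ρ g v)
      apply_mem_toSubmodule := fun g w hw => by
        induction hw using Submodule.span_induction with
        | mem x hx =>
          obtain ⟨g', rfl⟩ := hx
          exact Submodule.subset_span ⟨g * g', by simp⟩
        | zero => simp
        | add x y _ _ hx hy => rw [map_add]; exact Submodule.add_mem _ hx hy
        | smul a x _ hx => rw [map_smul]; exact Submodule.smul_mem _ a hx }
  have hvW : v ∈ W.toSubmodule := Submodule.subset_span ⟨1, by simp⟩
  have hW : W = ⊤ := by
    refine (h.eq_bot_or_eq_top W).resolve_left fun hb => hv ?_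
    rw [hb] at hvW
    exact (Submodule.mem_bot F).1 hvW
  refine ⟨⟨?_⟩, hnt⟩
  have htop : W.toSubmodule = ⊤ := congrArg Subrepresentation.toSubmodule hW
  rw [← htop]
  exact Submodule.fg_span (Set.finite_range _)

/-- A nonzero subrepresentation of a finite-dimensional representation contains an irreducible
one. -/
lemma Subrepresentation.exists_isIrreducible_le {F G H : Type*} [Field F] [Group G]
    [AddCommGroup H] [Module F H] [FiniteDimensional F H] {R : Representation F G H}
    (C : Subrepresentation R) (hC : C.toSubmodule ≠ ⊥) :
    ∃ W : Subrepresentation R, W.toSubmodule ≤ C.toSubmodule ∧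
      W.toRepresentation.IsIrreducible := by
  obtain ⟨W, ⟨hW0, hWC⟩, hmin⟩ := WellFounded.has_min
    (measure fun W : Subrepresentation R => Module.finrank F W.toSubmodule).wf
    {W | W.toSubmodule ≠ ⊥ ∧ W.toSubmodule ≤ C.toSubmodule} ⟨C, hC, le_rfl⟩
  refine ⟨W, hWC, ?_⟩
  have hnt : Nontrivial (Subrepresentation W.toRepresentation) := by
    refine ⟨⊥, ⊤, fun h => hW0 ?_⟩
    have h1 : (⊥ : Submodule F W.toSubmodule) = ⊤ := congrArg Subrepresentation.toSubmodule h
    rw [eq_bot_iff]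
    intro x hx
    have h2 : (⟨x, hx⟩ : W.toSubmodule) ∈ (⊥ : Submodule F W.toSubmodule) := h1 ▸ trivial
    simpa using h2
  refine ⟨fun N => ?_⟩
  by_cases hN : N.toSubmodule = ⊥
  · exact Or.inl (Subrepresentation.toSubmodule_injective hN)
  right
  let N' : Subrepresentation R :=
    { toSubmodule := N.toSubmodule.map W.toSubmodule.subtype
      apply_mem_toSubmodule := by
        rintro g _ ⟨w, hw, rfl⟩
        exact ⟨W.toRepresentation g w, N.apply_mem_toSubmodule g hw, rfl⟩ }
  have hle : N'.toSubmodule ≤ W.toSubmodule := Submodule.map_subtype_le _ _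
  have h1 := hmin N' ⟨fun h0 => hN (Submodule.map_injective_of_injective
    W.toSubmodule.injective_subtype (h0.trans (Submodule.map_bot _).symm)), hle.trans hWC⟩
  have h2 : N'.toSubmodule = W.toSubmodule :=
    Submodule.eq_of_le_of_finrank_le hle (not_lt.1 h1)
  refine Subrepresentation.toSubmodule_injective ?_
  change N.toSubmodule = ⊤
  rw [eq_top_iff]
  rintro ⟨x, hx⟩ -
  rw [← h2] at hx
  obtain ⟨w, hw, rfl⟩ := hx
  exact hw

variable {F : Type u} [Field F] [CharZero F] {𝒢 : Type*} [Group 𝒢] {H : Type*} [AddCommGroup H]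
  [Module F H] (R : Representation F 𝒢 H) (Γ : Subgroup 𝒢) [Finite Γ]

/-- If an irreducible representation of a finite subgroup is a quotient of a finite-dimensional
representation, and `φ` centralizes the subgroup, then there is an isotypic irreducible
subrepresentation for the group generated by `φ` and the subgroup. -/
theorem exists_isotypic_subrepresentation [FiniteDimensional F H] (φ : 𝒢)
    (hφ : ∀ γ ∈ Γ, φ * γ = γ * φ) {V : Type v} [AddCommGroup V] [Module F V]
    (ρ : Representation F Γ V) (hρ : ρ.IsIrreducible) (T : H →ₗ[F] V) (hT0 : T ≠ 0)
    (hT : ∀ (γ : Γ) x, T (R γ x) = ρ γ (T x)) :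
    ∃ W : Subrepresentation (R.comp (Subgroup.zpowers φ ⊔ Γ).subtype),
      W.toRepresentation.IsIrreducible ∧
      IsIsotypicOfType F[Γ] (restrictTo le_sup_right W.toRepresentation).asModule ρ.asModule := by
  have : NeZero (Nat.card Γ : F) := ⟨Nat.cast_ne_zero.2 Nat.card_pos.ne'⟩
  let σ : Representation F Γ H := R.comp Γ.subtype
  have hsimple : IsSimpleModule F[Γ] ρ.asModule :=
    (Representation.irreducible_iff_isSimpleModule_asModule ρ).1 hρ
  let t : σ.asModule →ₗ[F[Γ]] ρ.asModule := Representation.IntertwiningMap.equivLinearMapAsModule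
    σ ρ (T.intertwiningMap_of_isIntertwiningMap σ ρ hT)
  have ht0 : t ≠ 0 := fun h => hT0 (LinearMap.ext fun x => LinearMap.congr_fun h x)
  have htsurj : Function.Surjective t := t.surjective_of_ne_zero ht0
  let C := isotypicComponent F[Γ] σ.asModule ρ.asModule
  have hC : C ≠ ⊥ := by
    -- By Maschke's theorem the surjection onto `V` splits, and the image of the splitting is a copy
    -- of `V` inside the isotypic component.
    obtain ⟨s, hs⟩ := IsSemisimpleModule.lifting_property t htsurj LinearMap.id
    have hinj : Function.Injective s :=
      Function.LeftInverse.injective (g := t) fun x => LinearMap.congr_fun hs x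
    intro h
    have hle : LinearMap.range s ≤ C := le_sSup ⟨(LinearEquiv.ofInjective s hinj).symm⟩
    rw [h, le_bot_iff, LinearMap.range_eq_bot] at hle
    refine ht0 ?_
    rw [hle, LinearMap.comp_zero] at hs
    ext x
    have := LinearMap.congr_fun hs (t x)
    simpa using this.symm
  let C' : Subrepresentation σ := Subrepresentation.ofSubmodule' C
  have hC' : C'.toSubmodule ≠ ⊥ := by
    intro h
    refine hC ((Submodule.eq_bot_iff _).2 fun x hx => ?_)
    have : x ∈ C'.toSubmodule := hx
    rw [h] at this
    exact this
  let stab : Subgroup 𝒢 :=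
    { carrier := {s | C'.toSubmodule.map (R s) = C'.toSubmodule}
      one_mem' := by
        change C'.toSubmodule.map (R 1) = _
        rw [map_one]
        exact Submodule.map_id _
      mul_mem' := fun {a b} ha hb => by
        change C'.toSubmodule.map (R (a * b)) = _
        rw [map_mul]
        exact (Submodule.map_comp _ _ _).trans ((congrArg _ hb).trans ha)
      inv_mem' := fun {a} ha => by
        change C'.toSubmodule.map (R a⁻¹) = _
        conv_lhs => rw [← show C'.toSubmodule.map (R a) = C'.toSubmodule from ha]
        rw [← Submodule.map_comp]
        have : R a⁻¹ ∘ₗ R a = LinearMap.id := by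
          change R a⁻¹ * R a = 1
          rw [← map_mul, inv_mul_cancel, map_one]
        rw [this, Submodule.map_id] }
  have hle_of (s : 𝒢) (h1 : ∀ x ∈ C'.toSubmodule, R s x ∈ C'.toSubmodule)
      (h2 : ∀ x ∈ C'.toSubmodule, R s⁻¹ x ∈ C'.toSubmodule) : s ∈ stab := by
    refine le_antisymm (Submodule.map_le_iff_le_comap.2 h1) fun x hx => ⟨_, h2 x hx, ?_⟩
    rw [← Module.End.mul_apply, ← map_mul, mul_inv_cancel, map_one, Module.End.one_apply]
  -- An element commuting with `Γ` acts by an `F[Γ]`-endomorphism, and isotypic components are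
  -- invariant under all endomorphisms.
  have hcentral (s : 𝒢) (hs : ∀ γ ∈ Γ, s * γ = γ * s) :
      ∀ x ∈ C'.toSubmodule, R s x ∈ C'.toSubmodule := by
    let f : σ.asModule →ₗ[F[Γ]] σ.asModule :=
      Representation.IntertwiningMap.equivLinearMapAsModule σ σ
        ((R s).intertwiningMap_of_isIntertwiningMap σ σ fun γ x => by
          change (R s * R γ) x = (R γ * R s) x
          rw [← map_mul, ← map_mul, hs γ γ.2])
    intro x hx
    exact Submodule.IsFullyInvariant.isotypicComponent F[Γ] σ.asModule ρ.asModule f hx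
  have hstab : Subgroup.zpowers φ ⊔ Γ ≤ stab := by
    refine sup_le ((Subgroup.zpowers_le).2 (hle_of φ (hcentral φ hφ) (hcentral φ⁻¹ ?_)))
      fun γ hγ => hle_of γ (fun x hx => C'.apply_mem_toSubmodule ⟨γ, hγ⟩ hx)
        fun x hx => C'.apply_mem_toSubmodule ⟨γ⁻¹, inv_mem hγ⟩ hx
    intro γ hγ
    rw [inv_mul_eq_iff_eq_mul, ← mul_assoc, hφ γ hγ, mul_inv_cancel_right]
  let D : Subrepresentation (R.comp (Subgroup.zpowers φ ⊔ Γ).subtype) :=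
    { toSubmodule := C'.toSubmodule
      apply_mem_toSubmodule := fun s x hx => by
        have h : C'.toSubmodule.map (R s.1) = C'.toSubmodule := hstab s.2
        have h' := Submodule.mem_map_of_mem (f := R s.1) hx
        rw [h] at h'
        exact h' }
  obtain ⟨W, hWD, hW⟩ := D.exists_isIrreducible_le hC'
  refine ⟨W, hW, ?_⟩
  let j := Representation.IntertwiningMap.equivLinearMapAsModule
    (restrictTo le_sup_right W.toRepresentation) σ
    (W.toSubmodule.subtype.intertwiningMap_of_isIntertwiningMap
      (restrictTo le_sup_right W.toRepresentation) σ fun γ x => rfl)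
  refine IsIsotypicOfType.of_injective (.isotypicComponent F[Γ] σ.asModule ρ.asModule)
    (j.codRestrict C fun x => hWD x.2) ?_
  intro a b hab
  exact Subtype.ext (congrArg (fun c => (c.1 : H)) hab)

omit [CharZero F] [Finite Γ] in
/-- If a representation is irreducible for a cyclic group that normalizes a finite subgroup, and the
subgroup has a nonzero fixed vector, then it acts trivially. -/
lemma apply_eq_of_isIrreducible_zpowers (ψ : 𝒢) (hψ : ψ ∈ Subgroup.normalizer (Γ : Set 𝒢))
    (hirr : Representation.IsIrreducible (R.comp (Subgroup.zpowers ψ).subtype)) {x : H} (hx : x ≠ 0)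
    (hfix : ∀ γ ∈ Γ, R γ x = x) : ∀ γ ∈ Γ, ∀ y, R γ y = y := by
  have hnorm : Subgroup.zpowers ψ ≤ Subgroup.normalizer (Γ : Set 𝒢) :=
    Subgroup.zpowers_le.2 hψ
  let W : Subrepresentation (R.comp (Subgroup.zpowers ψ).subtype) :=
    { toSubmodule := ⨅ γ : Γ, LinearMap.eqLocus (R γ) LinearMap.id
      apply_mem_toSubmodule := fun s y hy => by
        simp only [Submodule.mem_iInf, LinearMap.mem_eqLocus, LinearMap.id_apply] at hy ⊢
        intro γ
        have hs : s.1⁻¹ * γ.1 * s.1 ∈ Γ := by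
          have := (Subgroup.mem_normalizer_iff.1 (inv_mem (hnorm s.2)) γ.1).1 γ.2
          rwa [inv_inv] at this
        have h1 := hy ⟨_, hs⟩
        change R γ.1 (R s.1 y) = R s.1 y
        conv_rhs => rw [← h1]
        simp only [← Module.End.mul_apply, ← map_mul]
        group }
  have hW : W = ⊤ := by
    refine (hirr.eq_bot_or_eq_top W).resolve_left fun hb => hx ?_
    have hxW : x ∈ W.toSubmodule := by
      simp only [W, Submodule.mem_iInf, LinearMap.mem_eqLocus, LinearMap.id_apply]
      exact fun γ => hfix γ γ.2
    rw [hb] at hxW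
    exact (Submodule.mem_bot F).1 hxW
  intro γ hγ y
  have hy : y ∈ W.toSubmodule := by rw [hW]; trivial
  simp only [W, Submodule.mem_iInf, LinearMap.mem_eqLocus, LinearMap.id_apply] at hy
  exact hy ⟨γ, hγ⟩

/-- Translation of functions on a group. -/
def translationRep (F G : Type*) [Field F] [Group G] : Representation F G (G → F) where
  toFun g := LinearMap.funLeft F F (g⁻¹ * ·)
  map_one' := by ext f; simp [LinearMap.funLeft_apply]
  map_mul' a b := by ext f; simp [LinearMap.funLeft_apply, mul_assoc]

lemma translationRep_apply {F G : Type*} [Field F] [Group G] (g : G) (f : G → F) (x : G) :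
    translationRep F G g f x = f (g⁻¹ * x) := rfl

/-- The functions with sum zero, as a subrepresentation. -/
def augmentation (F G : Type*) [Field F] [Group G] [Fintype G] :
    Subrepresentation (translationRep F G) where
  toSubmodule := LinearMap.ker (∑ x, LinearMap.proj x : (G → F) →ₗ[F] F)
  apply_mem_toSubmodule g f hf := by
    simp only [LinearMap.mem_ker, LinearMap.sum_apply, LinearMap.proj_apply,
      translationRep_apply] at hf ⊢
    rw [← hf]
    exact Fintype.sum_equiv (Equiv.mulLeft g⁻¹) _ _ fun x => rfl

lemma mem_augmentation {F G : Type*} [Field F] [Group G] [Fintype G] {f : G → F} :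
    f ∈ (augmentation F G).toSubmodule ↔ ∑ x, f x = 0 := by
  simp [augmentation]

/-- If every nonzero representation of a finite subgroup receives a nonzero equivariant map from a
representation that is irreducible for a cyclic group normalizing the subgroup, then the subgroup
is trivial. -/
theorem eq_bot_of_isIrreducible_zpowers {𝒢 : Type u} [Group 𝒢] (R : Representation F 𝒢 H)
    (Γ : Subgroup 𝒢) [Finite Γ]
    (hocc : ∀ (V : Type u) [AddCommGroup V] [Module F V] [FiniteDimensional F V] [Nontrivial V]
      (ρ : Representation F Γ V),
      ∃ T : H →ₗ[F] V, T ≠ 0 ∧ ∀ (γ : Γ) x, T (R γ x) = ρ γ (T x))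
    (ψ : 𝒢) (hψ : ψ ∈ Subgroup.normalizer (Γ : Set 𝒢))
    (hirr : Representation.IsIrreducible (R.comp (Subgroup.zpowers ψ).subtype)) : Γ = ⊥ := by
  classical
  have := Fintype.ofFinite Γ
  have hcard : (Fintype.card Γ : F) ≠ 0 := Nat.cast_ne_zero.2 Fintype.card_ne_zero
  have htriv : ∀ γ ∈ Γ, ∀ y, R γ y = y := by
    -- For the trivial representation, the orbit sum of a vector `x` with `T x ≠ 0` is fixed, and
    -- `T` maps it to `|Γ| • T x`, so it is nonzero.
    obtain ⟨T, hT0, hT⟩ := hocc F (1 : Representation F Γ F)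
    obtain ⟨x, hx⟩ : ∃ x, T x ≠ 0 := by
      by_contra h
      push Not at h
      exact hT0 (LinearMap.ext h)
    refine apply_eq_of_isIrreducible_zpowers R Γ ψ hψ hirr (x := ∑ γ : Γ, R γ x) ?_ ?_
    · intro h0
      have h1 := congrArg T h0
      rw [map_sum, map_zero, Finset.sum_congr rfl fun γ _ => hT γ x] at h1
      simp only [MonoidHom.one_apply, Module.End.one_apply, Finset.sum_const, Finset.card_univ,
        nsmul_eq_mul] at h1
      exact (mul_ne_zero hcard hx) h1
    · intro γ hγ
      rw [map_sum]
      refine Fintype.sum_equiv (Equiv.mulLeft (⟨γ, hγ⟩ : Γ)) _ _ fun δ => ?_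
      rw [← Module.End.mul_apply, ← map_mul]
      rfl
  rw [Subgroup.eq_bot_iff_forall]
  by_contra hne
  push Not at hne
  obtain ⟨γ, hγ, hγ1⟩ := hne
  let W := augmentation F Γ
  have hnt : Nontrivial W.toSubmodule := by
    have hmem : (Pi.single (⟨γ, hγ⟩ : Γ) 1 - Pi.single 1 1 : Γ → F) ∈ W.toSubmodule := by
      rw [mem_augmentation]
      simp
    refine ⟨⟨_, hmem⟩, 0, fun h => ?_⟩
    have h1 := congrFun (congrArg Subtype.val h) 1
    have h2 : (1 : Γ) ≠ ⟨γ, hγ⟩ := fun h => hγ1 (congrArg Subtype.val h).symm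
    simp [h2] at h1
  obtain ⟨T, hT0, hT⟩ := hocc W.toSubmodule W.toRepresentation
  refine hT0 (LinearMap.ext fun x => Subtype.ext (funext fun δ => ?_))
  -- As `Γ` acts trivially on the source, `T x` is a translation-invariant function, hence constant;
  -- its sum is zero, so it vanishes in characteristic zero.
  have hconst (ε : Γ) : (T x).1 ε = (T x).1 δ := by
    have h1 := hT (δ * ε⁻¹) x
    rw [htriv _ (δ * ε⁻¹).2] at h1
    have h2 : (T x).1 δ = (T x).1 ((δ * ε⁻¹)⁻¹ * δ) := congrFun (congrArg Subtype.val h1) δ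
    rw [h2]
    group
  have hsum := mem_augmentation.1 (T x).2
  rw [Finset.sum_congr rfl fun ε _ => hconst ε] at hsum
  simp only [Finset.sum_const, Finset.card_univ, nsmul_eq_mul] at hsum
  exact (mul_eq_zero.1 hsum).resolve_left hcard

end Algebra

/-! ### Application to the surface and its covering -/

section Surface

variable {g n : ℕ} {X : Type*} {X' : Type u} [TopologicalSpace X] [TopologicalSpace X']

lemma IsFiniteRegularCover.homeomorph_comp {Z : Type*} [TopologicalSpace Z] {p : X' → X}
    (hp : IsFiniteRegularCover p) (e : X ≃ₜ Z) :
    IsFiniteRegularCover (e ∘ p) ∧ deckGroup (e ∘ p) = deckGroup p := by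
  have hdeck : deckGroup (e ∘ p) = deckGroup p := by
    ext γ
    exact forall_congr' fun y => e.injective.eq_iff
  refine ⟨⟨hp.isCoveringMap.homeomorph_comp e, hp.pathConnected, fun z => ?_, fun y z h => ?_⟩,
    hdeck⟩
  · convert hp.finite_fiber (e.symm z) using 1
    ext y
    simp [e.eq_symm_apply]
  · rw [hdeck]
    exact hp.exists_deck y z (e.injective h)

/-- The homology of a finite regular covering of a surface of hyperbolic type is finite-dimensional
and has every nonzero representation of the deck group as an equivariant target. -/
theorem homology_of_finiteRegularCover (hgn : 2 < 2 * g + n) (hX : IsSurfaceOfType g n X)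
    {p : X' → X} (hp : IsFiniteRegularCover p) (F : Type u) [Field F] [CharZero F] :
    FiniteDimensional F (H1 F X') ∧
    ∀ (V : Type v) [AddCommGroup V] [Module F V] [FiniteDimensional F V] [Nontrivial V]
      (ρ : Representation F (deckGroup p) V),
      ∃ T : H1 F X' →ₗ[F] V, T ≠ 0 ∧
        ∀ (γ : deckGroup p) x, T (homologyRep F X' γ.1 x) = ρ γ (T x) := by
  obtain ⟨m, K, P, -, hχ, hn, hP, ⟨e⟩⟩ := hX
  obtain ⟨hq, hdeck⟩ := hp.homeomorph_comp e
  have := hq.pathConnected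
  have := finite_deckGroup hq
  have hsurj := ClosedTriangulation.surjective_of_isCoveringMap hP hq.isCoveringMap
  refine ⟨?_, ?_⟩
  · obtain ⟨-, S', -⟩ := exists_lifted_starCover hq hsurj (K.starCover P hP)
    exact S'.finiteDimensional_H1 F
  · rw [← hdeck]
    intro V _ _ _ _ ρ
    obtain ⟨t, ht, H⟩ := exists_equivariant_map_ne_zero F hq hsurj (K.starCover P hP)
    obtain ⟨ε, h1, h2⟩ := StarCover.exists_twisted_cocycle ρ ht
      (ClosedTriangulation.card_add_card_triangles_lt hP hgn hχ hn)
    exact H V ρ ε h1 h2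

/-- The conjugate of a deck transformation by `ψ'` covers the conjugate of the identity by `ψ`. -/
lemma mem_normalizer_deckGroup {p : X' → X} {ψ : X ≃ₜ X} {ψ' : X' ≃ₜ X'}
    (hψ : ∀ y, p (ψ' y) = ψ (p y)) :
    ψ' ∈ Subgroup.normalizer (deckGroup p : Set (X' ≃ₜ X')) := by
  rw [Subgroup.mem_normalizer_iff]
  intro γ
  constructor
  · intro h y
    change p (ψ' (γ (ψ'.symm y))) = p y
    rw [hψ, h, ← hψ, ψ'.apply_symm_apply]
  · intro h y
    have h1 : p (ψ' (γ (ψ'.symm (ψ' y)))) = p (ψ' y) := h (ψ' y)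
    rw [ψ'.symm_apply_apply, hψ, hψ] at h1
    exact ψ.injective h1

/-- A positive power of an element normalizing a finite subgroup centralizes it. -/
lemma Subgroup.exists_pow_centralizes {𝒢 : Type*} [Group 𝒢] (Γ : Subgroup 𝒢) [Finite Γ] {ψ : 𝒢}
    (hψ : ψ ∈ Subgroup.normalizer (Γ : Set 𝒢)) :
    ∃ k : ℕ, 0 < k ∧ ∀ γ ∈ Γ, ψ ^ k * γ = γ * ψ ^ k := by
  have : Finite (MulAut Γ) := Finite.of_injective (fun f : MulAut Γ => (f : Γ → Γ))
    DFunLike.coe_injective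
  -- Conjugation by `ψ` is an element of the finite group of automorphisms of `Γ`; its order is the
  -- exponent.
  let f := Γ.normalizerMonoidHom ⟨ψ, hψ⟩
  refine ⟨orderOf f, orderOf_pos f, fun γ hγ => ?_⟩
  have h1 : Γ.normalizerMonoidHom (⟨ψ, hψ⟩ ^ orderOf f) = 1 := by
    rw [map_pow]; exact pow_orderOf_eq_one f
  have h2 := congrArg Subtype.val (DFunLike.congr_fun h1 (⟨γ, hγ⟩ : Γ))
  have h3 : ψ ^ orderOf f * γ * (ψ ^ orderOf f)⁻¹ = γ := h2
  rwa [mul_inv_eq_iff_eq_mul] at h3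

end Surface

theorem theorem1p7 {g n : ℕ} (hgn : 2 < 2 * g + n)
    {X X' : Type u} [TopologicalSpace X] [TopologicalSpace X']
    (hX : IsSurfaceOfType g n X)
    (p : X' → X) (hp : IsFiniteRegularCover p)
    (ψ : X ≃ₜ X) (ψ' : X' ≃ₜ X') (hψ : ∀ y, p (ψ' y) = ψ (p y))
    (F : Type u) [Field F] [CharZero F] :
    ((homologyRepOn F (Subgroup.zpowers ψ')).IsIrreducible → deckGroup p = ⊥) ∧
    ∃ k : ℕ, 0 < k ∧
      ∀ (V : Type v) [AddCommGroup V] [Module F V] (ρ : Representation F (deckGroup p) V),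
        ρ.IsIrreducible →
        ∃ W : Subrepresentation
            (homologyRepOn F (Subgroup.zpowers (ψ' ^ k) ⊔ deckGroup p)),
          W.toRepresentation.IsIrreducible ∧
          IsIsotypicOfType (MonoidAlgebra F (deckGroup p))
            (restrictTo le_sup_right W.toRepresentation).asModule ρ.asModule := by
  have := finite_deckGroup hp
  have hnorm := mem_normalizer_deckGroup hψ
  have hfin := (homology_of_finiteRegularCover.{u, v} hgn hX hp F).1
  refine ⟨fun hirr => eq_bot_of_isIrreducible_zpowers (homologyRep F X') _
    (homology_of_finiteRegularCover hgn hX hp F).2 ψ' hnorm hirr, ?_⟩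
  -- The exponent depends only on the conjugation action of `ψ'` on the deck group, so one `k`
  -- serves all `V`.
  obtain ⟨k, hk, hcomm⟩ := Subgroup.exists_pow_centralizes _ hnorm
  refine ⟨k, hk, fun V _ _ ρ hρ => ?_⟩
  obtain ⟨h1, h2⟩ := Representation.finiteDimensional_of_isIrreducible ρ hρ
  obtain ⟨T, hT0, hT⟩ := (homology_of_finiteRegularCover hgn hX hp F).2 V ρ
  exact exists_isotypic_subrepresentation (homologyRep F X') _ _ hcomm ρ hρ T hT0 hT
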